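/- **Conventions.** A *PCA* $\mathbb A=(A,\le,\cdot,A^\#)$ is a poset with a partial application such that, if $a\le a'$, $b\le b'$ and $a'b'$ is defined, then $ab$ is defined and $ab\le a'b'$, together with a subset $A^\#\subseteq A$ that is upward closed, closed under defined application, and contains elements $\mathbf k,\mathbf s$ with $\mathbf kab\preceq a$, $\mathbf sab$ defined, and $\mathbf sabc\preceq ac(bc)$ for all $a,b,c$; here $e\preceq e'$ means: if $e'$ is defined, then $e$ is defined and $e\le e'$. A *morphism of PCAs* $f:\mathbb A\to\mathbb B$ is a function $A\to B$ with $f(A^\#)\subseteq B^\#$ for which there are $t,u\in B^\#$ with $t\,f(a)f(a')\preceq f(aa')$ whenever $aa'$ is defined, and $u\,f(a)\preceq f(a')$ whenever $a\le a'$. Put $f\le f'$ if some $s\in B^\#$ satisfies $s\,f(a)\preceq f'(a)$ for all $a$. It is *computationally dense* if there is $m\in B^\#$ such that for every $s\in B^\#$ there is $r\in A^\#$ with $m\,f(ra)\preceq s\,f(a)$ for all $a\in A$. The set $DA$ of downward closed subsets of $A$, ordered by inclusion, is a PCA $D\mathbb A$: $\alpha\cdot\beta$ is defined if $xy$ is defined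 for all $x\in\alpha$, $y\in\beta$, and is then the downset generated by these $xy$; and $(DA)^\#=\{\alpha\in DA : \alpha\cap A^\#\ne\emptyset\}$. Let $\mathrm{OPCA}_D$ be the preorder-enriched bicategory of PCAs in which a 1-cell $\mathbb A\to\mathbb B$ (a *partial applicative morphism*) is a morphism of PCAs $\mathbb A\to D\mathbb B$, the identity is $a\mapsto{\downarrow}\{a\}$, and the composite $gf$ is $a\mapsto\bigcup_{b\in f(a)}g(b)$. Let $\mathrm{OPCA}_{D,\mathrm{cd}}$ be its wide sub-bicategory on the 1-cells that are computationally dense as morphisms of PCAs $\mathbb A\to D\mathbb B$. An *arrow algebra* $\mathcal A=(A,\le,\to,S)$ is a complete lattice with an operation $\to$, antitone in the first and monotone in the second argument, and an upward closed subset $S$ that is closed under modus ponens and contains $\bigwedge_{a,b}a\to b\to a$, $\ \bigwedge_{a,b,c}(a\to b\to c)\to(a\to b)\to a\to c$ and $\bigwedge_{a,(b_i),(c_i)}\big(\bigwedge_i a\to b_i\to c_i\big)\to a\to\bigwedge_i(b_i\to c_i)$. For $\phi,\psi:I\to A$ write $\phi\vdash_I\psi$ if $\bigwedge_i\phi(i)\to\psi(i)\in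 S$. An *implicative morphism* $f:\mathcal A\to\mathcal B$ is a function $A\to B$ such that $f(S_A)\subseteq S_B$; some $r\in S_B$ satisfies $r\le f(a\to a')\to f(a)\to f(a')$ for all $a,a'$; and for each $X\subseteq A\times A$, $\bigwedge_{(a,a')\in X}a\to a'\in S_A$ implies $\bigwedge_{(a,a')\in X}f(a)\to f(a')\in S_B$. Put $f\vdash f'$ if some $r\in S_B$ satisfies $r\le f(a)\to f'(a)$ for all $a$. This gives a preorder-enriched category $\mathrm{ArrAlg}$. For $g:X\to Y$ and $\alpha:X\to A$ let $\exists_g(\alpha)(y)=\bigwedge_{a\in A}\big(\bigwedge_{g(x)=y}\alpha(x)\to\partial a\big)\to\partial\partial a$, where $\partial a=(\top\to a)$. An implicative morphism $f$ is *regular* if $f\circ\exists_g(\alpha)\vdash_Y\exists_g(f\circ\alpha)$ and $\exists_g(f\circ\alpha)\vdash_Y f\circ\exists_g(\alpha)$ for all sets $X,Y$ and all such $g,\alpha$; it is *computationally dense* if it has a right adjoint in $\mathrm{ArrAlg}$, i.e. there is an implicative morphism $h:\mathcal B\to\mathcal A$ with $fh\vdash\mathrm{id}$ and $\mathrm{id}\vdash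 hf$. Let $\mathrm{ArrAlg}_{\mathrm{reg}}$ and $\mathrm{ArrAlg}_{\mathrm{cd}}$ be the corresponding wide subcategories. For a PCA $\mathbb A$, the poset $DA$ with $\alpha\to\beta=\{a : ax\text{ is defined and }ax\in\beta\text{ for all }x\in\alpha\}$ and $S=(DA)^\#$ is an arrow algebra, again written $D\mathbb A$. Let $\widetilde D:\mathrm{OPCA}_D\to\mathrm{ArrAlg}$ be the 2-functor $\mathbb A\mapsto D\mathbb A$, $f\mapsto\widetilde f$, with $\widetilde f(\alpha)=\bigcup_{a\in\alpha}f(a)$. A 2-functor is *2-fully faithful* if it is an equivalence of preorder categories on all hom-preorders. **Proposition.** 1. $\widetilde D$ restricts to a 2-fully faithful 2-functor $\mathrm{OPCA}_D\to\mathrm{ArrAlg}_{\mathrm{reg}}$: each $\widetilde f$ is regular, and for all PCAs $\mathbb A,\mathbb B$, $\widetilde D$ realizes an equivalence of preorder categories $\mathrm{OPCA}_D(\mathbb A,\mathbb B)\simeq\mathrm{ArrAlg}_{\mathrm{reg}}(D\mathbb A,D\mathbb B)$. 2. $\widetilde D$ restricts to a 2-fully faithful 2-functor $\mathrm{OPCA}_{D,\mathrm{cd}}\to\mathrm{ArrAlg}_{\mathrm{cd}}$: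 if $f$ is computationally dense, so is $\widetilde f$, and for all PCAs $\mathbb A,\mathbb B$, $\widetilde D$ realizes an equivalence of preorder categories $\mathrm{OPCA}_{D,\mathrm{cd}}(\mathbb A,\mathbb B)\simeq\mathrm{ArrAlg}_{\mathrm{cd}}(D\mathbb A,D\mathbb B)$. 3. A partial applicative morphism $f$ is computationally dense if and only if $\widetilde f$ is computationally dense as an implicative morphism. -/

import Mathlib

open CategoryTheory

universe u v

namespace RealArrow

/-! ### Partial applicative posets and PCAs -/

/-- Kleene inequality between possibly undefined elements of a poset:
if `y` is defined, then so is `x`, and `x ≤ y`. -/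
def KleeneLE {A : Type u} [LE A] (x y : Part A) : Prop :=
  ∀ b ∈ y, ∃ a ∈ x, a ≤ b

/-- A partial applicative poset. -/
structure PartialApplicativePoset : Type (u + 1) where
  carrier : Type u
  [order : PartialOrder carrier]
  app : carrier → carrier → Part carrier
  app_mono : ∀ {a a' b b' : carrier}, a ≤ a' → b ≤ b' → KleeneLE (app a b) (app a' b')

attribute [instance] PartialApplicativePoset.order

/-- Application of possibly undefined expressions; it is defined when both expressions are,
and their values can be applied. -/
def PartialApplicativePoset.ap (P : PartialApplicativePoset.{u}) (x y : Part P.carrier) :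
    Part P.carrier :=
  x.bind fun a => y.bind fun b => P.app a b

/-- A partial combinatory algebra (ordered, partial, with a filter). -/
structure PCA : Type (u + 1) extends PartialApplicativePoset.{u} where
  filter : Set carrier
  filter_up : ∀ {a b : carrier}, a ∈ filter → a ≤ b → b ∈ filter
  filter_app : ∀ {a b c : carrier}, a ∈ filter → b ∈ filter → c ∈ app a b → c ∈ filter
  exists_k : ∃ k ∈ filter, ∀ a b : carrier,
    KleeneLE (toPartialApplicativePoset.ap (toPartialApplicativePoset.ap (Part.some k)
      (Part.some a)) (Part.some b)) (Part.some a)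
  exists_s : ∃ s ∈ filter, ∀ a b : carrier,
    (toPartialApplicativePoset.ap (toPartialApplicativePoset.ap (Part.some s)
      (Part.some a)) (Part.some b)).Dom ∧
    ∀ c : carrier, KleeneLE
      (toPartialApplicativePoset.ap (toPartialApplicativePoset.ap
        (toPartialApplicativePoset.ap (Part.some s) (Part.some a)) (Part.some b)) (Part.some c))
      (toPartialApplicativePoset.ap
        (toPartialApplicativePoset.ap (Part.some a) (Part.some c))
        (toPartialApplicativePoset.ap (Part.some b) (Part.some c)))

theorem KleeneLE.refl {A : Type u} [Preorder A] (x : Part A) : KleeneLE x x :=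
  fun b hb => ⟨b, hb, le_rfl⟩

theorem KleeneLE.trans {A : Type u} [Preorder A] {x y z : Part A} (h : KleeneLE x y)
    (h' : KleeneLE y z) : KleeneLE x z := by
  intro c hc
  obtain ⟨b, hb, hbc⟩ := h' c hc
  obtain ⟨a, ha, hab⟩ := h b hb
  exact ⟨a, ha, hab.trans hbc⟩

theorem kleeneLE_some {A : Type u} [Preorder A] {x : Part A} {c : A} :
    KleeneLE x (Part.some c) ↔ ∃ a ∈ x, a ≤ c := by
  simp [KleeneLE]

theorem kleeneLE_some_some {A : Type u} [Preorder A] {a b : A} (h : a ≤ b) :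
    KleeneLE (Part.some a) (Part.some b) := by
  simpa [KleeneLE] using h

namespace PCA

variable (P : PCA.{u})

theorem mem_ap {x y : Part P.carrier} {c : P.carrier} :
    c ∈ P.ap x y ↔ ∃ a ∈ x, ∃ b ∈ y, c ∈ P.app a b := by
  simp [PartialApplicativePoset.ap, Part.mem_bind_iff]

theorem mem_ap_some {a b c : P.carrier} :
    c ∈ P.ap (Part.some a) (Part.some b) ↔ c ∈ P.app a b := by
  simp [mem_ap]

theorem ap_mono {x x' y y' : Part P.carrier} (h : KleeneLE x x') (h' : KleeneLE y y') :
    KleeneLE (P.ap x y) (P.ap x' y') := by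
  intro c hc
  obtain ⟨a, ha, b, hb, hc⟩ := (P.mem_ap).1 hc
  obtain ⟨a₁, ha₁, h₁⟩ := h a ha
  obtain ⟨b₁, hb₁, h₂⟩ := h' b hb
  obtain ⟨c₁, hc₁, h₃⟩ := P.app_mono h₁ h₂ c hc
  exact ⟨c₁, (P.mem_ap).2 ⟨a₁, ha₁, b₁, hb₁, hc₁⟩, h₃⟩

/-- Terms over a PCA, in de Bruijn style. -/
inductive Tm (A : Type u) : Type u
  | var : ℕ → Tm A
  | const : A → Tm A
  | app : Tm A → Tm A → Tm A

/-- The environment `e` extended by a value for the variable `0`. -/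
def push {A : Type u} (a : A) (e : ℕ → A) : ℕ → A
  | 0 => a
  | n + 1 => e n

/-- The possibly undefined value of a term. -/
def eval : Tm P.carrier → (ℕ → P.carrier) → Part P.carrier
  | .var n, e => Part.some (e n)
  | .const a, _ => Part.some a
  | .app t t', e => P.ap (eval t e) (eval t' e)

/-- All constants of a term lie in the filter. -/
def InFilter : Tm P.carrier → Prop
  | .var _ => True
  | .const a => a ∈ P.filter
  | .app t t' => InFilter t ∧ InFilter t'

theorem eval_mem_filter {t : Tm P.carrier} {e : ℕ → P.carrier} (ht : P.InFilter t)
    (he : ∀ n, e n ∈ P.filter) {c : P.carrier} (hc : c ∈ P.eval t e) : c ∈ P.filter := by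
  induction t generalizing c with
  | var n =>
    simp only [eval, Part.mem_some_iff] at hc
    exact hc ▸ he n
  | const a =>
    simp only [eval, Part.mem_some_iff] at hc
    exact hc ▸ ht
  | app t t' ih ih' =>
    obtain ⟨a, ha, b, hb, hc⟩ := (P.mem_ap).1 hc
    exact P.filter_app (ih ht.1 ha) (ih' ht.2 hb) hc

theorem exists_i : ∃ i ∈ P.filter, ∀ a, KleeneLE (P.ap (Part.some i) (Part.some a))
    (Part.some a) := by
  obtain ⟨k, hk, hk'⟩ := P.exists_k
  obtain ⟨s, hs, hs'⟩ := P.exists_s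
  have hd := (hs' k k).1
  obtain ⟨i, hi⟩ := Part.dom_iff_mem.1 hd
  have hif : i ∈ P.filter := P.eval_mem_filter
    (t := .app (.app (.const s) (.const k)) (.const k)) (e := fun _ => k) ⟨⟨hs, hk⟩, hk⟩
    (fun _ => hk) hi
  refine ⟨i, hif, fun a => ?_⟩
  have h1 := (hs' k k).2 a
  rw [Part.eq_some_iff.2 hi] at h1
  refine h1.trans ?_
  obtain ⟨c, hc, hca⟩ := kleeneLE_some.1 (hk' a a)
  obtain ⟨d, hd, -⟩ := (P.mem_ap).1 hc
  have := hk' a d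
  rwa [Part.eq_some_iff.2 hd] at this ⊢

/-- Abstraction of the variable `0`, for given elements `k`, `s`, `i`. -/
def abs (k s i : P.carrier) : Tm P.carrier → Tm P.carrier
  | .var 0 => .const i
  | .var (n + 1) => .app (.const k) (.var n)
  | .const a => .app (.const k) (.const a)
  | .app t t' => .app (.app (.const s) (abs k s i t)) (abs k s i t')

/-- Combinatory completeness, for one abstraction. -/
theorem exists_abs : ∃ L : Tm P.carrier → Tm P.carrier,
    (∀ t, P.InFilter t → P.InFilter (L t)) ∧
    (∀ t e, (P.eval (L t) e).Dom) ∧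
    ∀ t e a, KleeneLE (P.ap (P.eval (L t) e) (Part.some a)) (P.eval t (push a e)) := by
  obtain ⟨k, hk, hk'⟩ := P.exists_k
  obtain ⟨s, hs, hs'⟩ := P.exists_s
  obtain ⟨i, hi, hi'⟩ := P.exists_i
  have hkd : ∀ a, (P.ap (Part.some k) (Part.some a)).Dom := by
    intro a
    obtain ⟨c, hc, hca⟩ := kleeneLE_some.1 (hk' a a)
    obtain ⟨d, hd, -⟩ := (P.mem_ap).1 hc
    exact Part.dom_iff_mem.2 ⟨d, hd⟩
  have hD : ∀ t e, (P.eval (P.abs k s i t) e).Dom := by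
    intro t e
    induction t with
    | var n => cases n with
      | zero => trivial
      | succ n => exact hkd _
    | const a => exact hkd _
    | app t t' ih ih' =>
      obtain ⟨a, ha⟩ := Part.dom_iff_mem.1 ih
      obtain ⟨b, hb⟩ := Part.dom_iff_mem.1 ih'
      simp only [abs, eval]
      rw [Part.eq_some_iff.2 ha, Part.eq_some_iff.2 hb]
      exact (hs' a b).1
  refine ⟨P.abs k s i, ?_, hD, ?_⟩
  · intro t ht
    induction t with
    | var n => cases n with
      | zero => exact hi
      | succ n => exact ⟨hk, trivial⟩
    | const a => exact ⟨hk, ht⟩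
    | app t t' ih ih' => exact ⟨⟨hs, ih ht.1⟩, ih' ht.2⟩
  · intro t e a
    induction t with
    | var n => cases n with
      | zero => exact hi' a
      | succ n => exact hk' _ a
    | const c => exact hk' c a
    | app t t' ih ih' =>
      refine KleeneLE.trans ?_ (P.ap_mono ih ih')
      obtain ⟨b, hb⟩ := Part.dom_iff_mem.1 (hD t e)
      obtain ⟨c, hc⟩ := Part.dom_iff_mem.1 (hD t' e)
      simp only [abs, eval]
      rw [Part.eq_some_iff.2 hb, Part.eq_some_iff.2 hc]
      exact (hs' b c).2 a

/-- Combinatory completeness, for three abstractions. -/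
theorem exists_lam₃ (t : Tm P.carrier) (ht : P.InFilter t) : ∃ r ∈ P.filter, ∃ z ∈ P.filter,
    ∀ a b, (P.ap (P.ap (Part.some r) (Part.some a)) (Part.some b)).Dom ∧
      ∀ c, KleeneLE (P.ap (P.ap (P.ap (Part.some r) (Part.some a)) (Part.some b)) (Part.some c))
        (P.eval t (push c (push b (push a fun _ => z)))) := by
  obtain ⟨L, hL, hD, hE⟩ := P.exists_abs
  obtain ⟨z, hz, -⟩ := P.exists_k
  obtain ⟨r, hr⟩ := Part.dom_iff_mem.1 (hD (L (L t)) fun _ => z)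
  refine ⟨r, P.eval_mem_filter (hL _ (hL _ (hL _ ht))) (fun _ => hz) hr, z, hz, fun a b => ?_⟩
  have h1 := hE (L (L t)) (fun _ => z) a
  rw [Part.eq_some_iff.2 hr] at h1
  have h2 := (P.ap_mono h1 (KleeneLE.refl (Part.some b))).trans (hE (L t) (push a fun _ => z) b)
  refine ⟨?_, fun c => (P.ap_mono h2 (KleeneLE.refl (Part.some c))).trans (hE t _ c)⟩
  obtain ⟨d, hd⟩ := Part.dom_iff_mem.1 (hD t (push b (push a fun _ => z)))
  obtain ⟨d', hd', -⟩ := h2 d hd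
  exact Part.dom_iff_mem.2 ⟨d', hd'⟩

theorem exists_lam₂ (t : Tm P.carrier) (ht : P.InFilter t) : ∃ r ∈ P.filter, ∃ z ∈ P.filter,
    ∀ a, (P.ap (Part.some r) (Part.some a)).Dom ∧
      ∀ b, KleeneLE (P.ap (P.ap (Part.some r) (Part.some a)) (Part.some b))
        (P.eval t (push b (push a fun _ => z))) := by
  obtain ⟨L, hL, hD, hE⟩ := P.exists_abs
  obtain ⟨z, hz, -⟩ := P.exists_k
  obtain ⟨r, hr⟩ := Part.dom_iff_mem.1 (hD (L t) fun _ => z)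
  refine ⟨r, P.eval_mem_filter (hL _ (hL _ ht)) (fun _ => hz) hr, z, hz, fun a => ?_⟩
  have h1 := hE (L t) (fun _ => z) a
  rw [Part.eq_some_iff.2 hr] at h1
  refine ⟨?_, fun b => (P.ap_mono h1 (KleeneLE.refl (Part.some b))).trans (hE t _ b)⟩
  obtain ⟨d, hd⟩ := Part.dom_iff_mem.1 (hD t (push a fun _ => z))
  obtain ⟨d', hd', -⟩ := h1 d hd
  exact Part.dom_iff_mem.2 ⟨d', hd'⟩

theorem exists_lam₁ (t : Tm P.carrier) (ht : P.InFilter t) : ∃ r ∈ P.filter, ∃ z ∈ P.filter,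
    ∀ a, KleeneLE (P.ap (Part.some r) (Part.some a)) (P.eval t (push a fun _ => z)) := by
  obtain ⟨L, hL, hD, hE⟩ := P.exists_abs
  obtain ⟨z, hz, -⟩ := P.exists_k
  obtain ⟨r, hr⟩ := Part.dom_iff_mem.1 (hD t fun _ => z)
  refine ⟨r, P.eval_mem_filter (hL _ ht) (fun _ => hz) hr, z, hz, fun a => ?_⟩
  have h1 := hE t (fun _ => z) a
  rwa [Part.eq_some_iff.2 hr] at h1

end PCA



/-! ### The downset PCA -/

namespace PCA

/-- Application of downsets: it is defined when all applications of elements are, and it is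
then the downset generated by them. -/
def downApp (P : PCA.{u}) (α β : LowerSet P.carrier) : Part (LowerSet P.carrier) where
  Dom := ∀ x ∈ α, ∀ y ∈ β, (P.app x y).Dom
  get _ := lowerClosure {z | ∃ x ∈ α, ∃ y ∈ β, z ∈ P.app x y}

variable (P : PCA.{u})

theorem downApp_le {α β γ : LowerSet P.carrier} :
    KleeneLE (P.downApp α β) (Part.some γ) ↔
      ∀ x ∈ α, ∀ y ∈ β, ∃ z ∈ P.app x y, z ∈ γ := by
  rw [kleeneLE_some]
  constructor
  · rintro ⟨δ, ⟨hd, rfl⟩, hδ⟩ x hx y hy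
    obtain ⟨z, hz⟩ := Part.dom_iff_mem.1 (hd x hx y hy)
    exact ⟨z, hz, hδ (subset_lowerClosure ⟨x, hx, y, hy, hz⟩)⟩
  · intro h
    refine ⟨_, ⟨fun x hx y hy => ?_, rfl⟩, ?_⟩
    · obtain ⟨z, hz, -⟩ := h x hx y hy
      exact Part.dom_iff_mem.2 ⟨z, hz⟩
    · rintro w ⟨z, ⟨x, hx, y, hy, hz⟩, hw⟩
      obtain ⟨z', hz', hz'γ⟩ := h x hx y hy
      exact γ.lower hw (Part.mem_unique hz' hz ▸ hz'γ)

theorem mem_of_downApp {α β δ : LowerSet P.carrier} (hδ : δ ∈ P.downApp α β)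
    {x y : P.carrier} (hx : x ∈ α) (hy : y ∈ β) : ∃ z ∈ P.app x y, z ∈ δ :=
  (P.downApp_le).1 (kleeneLE_some.2 ⟨δ, hδ, le_rfl⟩) x hx y hy

/-- Downsets with application, as a partial applicative poset. -/
abbrev downPoset : PartialApplicativePoset.{u} where
  carrier := LowerSet P.carrier
  app := P.downApp
  app_mono {α α' β β'} h h' δ hδ := by
    rw [← kleeneLE_some, downApp_le]
    exact fun x hx y hy => P.mem_of_downApp hδ (h hx) (h' hy)

theorem down_le₂ {X : Part (LowerSet P.carrier)} {β γ : LowerSet P.carrier} :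
    KleeneLE (P.downPoset.ap X (Part.some β)) (Part.some γ) ↔
      ∃ ξ ∈ X, ∀ x ∈ ξ, ∀ y ∈ β, ∃ z ∈ P.app x y, z ∈ γ := by
  rw [kleeneLE_some]
  constructor
  · rintro ⟨δ, hδ, hle⟩
    obtain ⟨ξ, hξ, h⟩ := Part.mem_bind_iff.1 hδ
    rw [Part.bind_some] at h
    exact ⟨ξ, hξ, (P.downApp_le).1 (kleeneLE_some.2 ⟨δ, h, hle⟩)⟩
  · rintro ⟨ξ, hξ, h⟩
    obtain ⟨δ, hδ, hle⟩ := kleeneLE_some.1 ((P.downApp_le).2 h)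
    refine ⟨δ, Part.mem_bind_iff.2 ⟨ξ, hξ, ?_⟩, hle⟩
    rw [Part.bind_some]
    exact hδ

theorem down_ap₁ {τ α γ : LowerSet P.carrier} :
    KleeneLE (P.downPoset.ap (Part.some τ) (Part.some α)) (Part.some γ) ↔
      ∀ t ∈ τ, ∀ a ∈ α, ∃ z ∈ P.ap (Part.some t) (Part.some a), z ∈ γ := by
  rw [down_le₂]
  simp [mem_ap]

theorem down_ap_step {X : Part (LowerSet P.carrier)} {β γ : LowerSet P.carrier}
    {S : Set (Part P.carrier)} (hd : X.Dom → ∀ s ∈ S, s.Dom)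
    (hX : ∀ γ, KleeneLE X (Part.some γ) ↔ ∀ s ∈ S, ∃ z ∈ s, z ∈ γ) :
    KleeneLE (P.downPoset.ap X (Part.some β)) (Part.some γ) ↔
      (∀ s ∈ S, s.Dom) ∧ ∀ s ∈ S, ∀ b ∈ β, ∃ z ∈ P.ap s (Part.some b), z ∈ γ := by
  rw [down_le₂]
  constructor
  · rintro ⟨ξ, hξ, h⟩
    refine ⟨hd (Part.dom_iff_mem.2 ⟨ξ, hξ⟩), fun s hs b hb => ?_⟩
    obtain ⟨x, hx, hxξ⟩ := (hX ξ).1 (kleeneLE_some.2 ⟨ξ, hξ, le_rfl⟩) s hs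
    obtain ⟨z, hz, hzγ⟩ := h x hxξ b hb
    exact ⟨z, (P.mem_ap).2 ⟨x, hx, b, Part.mem_some _, hz⟩, hzγ⟩
  · rintro ⟨hd, h⟩
    have hle : KleeneLE X (Part.some (lowerClosure {x | ∃ s ∈ S, x ∈ s})) := by
      rw [hX]
      intro s hs
      obtain ⟨z, hz⟩ := Part.dom_iff_mem.1 (hd s hs)
      exact ⟨z, hz, subset_lowerClosure ⟨s, hs, hz⟩⟩
    obtain ⟨ξ, hξ, hle⟩ := kleeneLE_some.1 hle
    refine ⟨ξ, hξ, fun x hx b hb => ?_⟩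
    obtain ⟨x₀, ⟨s, hs, hxs⟩, hxx⟩ := hle hx
    obtain ⟨z, hz, hzγ⟩ := h s hs b hb
    obtain ⟨x₁, hx₁, b₁, hb₁, hz'⟩ := (P.mem_ap).1 hz
    obtain rfl := Part.mem_unique hx₁ hxs
    obtain rfl := Part.mem_some_iff.1 hb₁
    obtain ⟨w, hw, hwz⟩ := P.app_mono hxx le_rfl z hz'
    exact ⟨w, hw, γ.lower hwz hzγ⟩

theorem down_ap₂ {τ α β γ : LowerSet P.carrier} :
    KleeneLE (P.downPoset.ap (P.downPoset.ap (Part.some τ) (Part.some α)) (Part.some β))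
      (Part.some γ) ↔
      (∀ t ∈ τ, ∀ a ∈ α, (P.ap (Part.some t) (Part.some a)).Dom) ∧
      ∀ t ∈ τ, ∀ a ∈ α, ∀ b ∈ β,
        ∃ z ∈ P.ap (P.ap (Part.some t) (Part.some a)) (Part.some b), z ∈ γ := by
  rw [P.down_ap_step (S := {s | ∃ t ∈ τ, ∃ a ∈ α, s = P.ap (Part.some t) (Part.some a)})]
  · constructor
    · rintro ⟨h, h'⟩
      exact ⟨fun t ht a ha => h _ ⟨t, ht, a, ha, rfl⟩,
        fun t ht a ha b hb => h' _ ⟨t, ht, a, ha, rfl⟩ b hb⟩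
    · rintro ⟨h, h'⟩
      refine ⟨?_, ?_⟩
      · rintro _ ⟨t, ht, a, ha, rfl⟩
        exact h t ht a ha
      · rintro _ ⟨t, ht, a, ha, rfl⟩ b hb
        exact h' t ht a ha b hb
  · rintro hd _ ⟨t, ht, a, ha, rfl⟩
    obtain ⟨δ, hδ⟩ := Part.dom_iff_mem.1 hd
    obtain ⟨z, hz, -⟩ := (P.down_ap₁).1 (kleeneLE_some.2 ⟨δ, hδ, le_rfl⟩) t ht a ha
    exact Part.dom_iff_mem.2 ⟨z, hz⟩
  · intro γ
    rw [down_ap₁]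
    constructor
    · rintro h _ ⟨t, ht, a, ha, rfl⟩
      exact h t ht a ha
    · exact fun h t ht a ha => h _ ⟨t, ht, a, ha, rfl⟩

theorem down_ap₃ {τ α β δ γ : LowerSet P.carrier} :
    KleeneLE (P.downPoset.ap (P.downPoset.ap (P.downPoset.ap (Part.some τ) (Part.some α))
      (Part.some β)) (Part.some δ)) (Part.some γ) ↔
      (P.downPoset.ap (P.downPoset.ap (Part.some τ) (Part.some α)) (Part.some β)).Dom ∧
      ∀ t ∈ τ, ∀ a ∈ α, ∀ b ∈ β, ∀ d ∈ δ,
        ∃ z ∈ P.ap (P.ap (P.ap (Part.some t) (Part.some a)) (Part.some b)) (Part.some d),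
          z ∈ γ := by
  constructor
  · intro h
    obtain ⟨ξ, hξ, h'⟩ := (P.down_le₂).1 h
    refine ⟨Part.dom_iff_mem.2 ⟨ξ, hξ⟩, fun t ht a ha b hb d hd => ?_⟩
    obtain ⟨x, hx, hxξ⟩ :=
      ((P.down_ap₂).1 (kleeneLE_some.2 ⟨ξ, hξ, le_rfl⟩)).2 t ht a ha b hb
    obtain ⟨z, hz, hzγ⟩ := h' x hxξ d hd
    exact ⟨z, (P.mem_ap).2 ⟨x, hx, d, Part.mem_some _, hz⟩, hzγ⟩
  · rintro ⟨hd, h⟩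
    obtain ⟨ξ', hξ'⟩ := Part.dom_iff_mem.1 hd
    have h₂ := (P.down_ap₂).1 (kleeneLE_some.2 ⟨ξ', hξ', le_rfl⟩)
    have hle : KleeneLE (P.downPoset.ap (P.downPoset.ap (Part.some τ) (Part.some α))
        (Part.some β)) (Part.some (lowerClosure {x | ∃ t ∈ τ, ∃ a ∈ α, ∃ b ∈ β,
          x ∈ P.ap (P.ap (Part.some t) (Part.some a)) (Part.some b)})) := by
      refine (P.down_ap₂).2 ⟨h₂.1, fun t ht a ha b hb => ?_⟩
      obtain ⟨z, hz, -⟩ := h₂.2 t ht a ha b hb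
      exact ⟨z, hz, subset_lowerClosure ⟨t, ht, a, ha, b, hb, hz⟩⟩
    obtain ⟨ξ, hξ, hle⟩ := kleeneLE_some.1 hle
    refine (P.down_le₂).2 ⟨ξ, hξ, fun x hx d hd => ?_⟩
    obtain ⟨x₀, ⟨t, ht, a, ha, b, hb, hx₀⟩, hxx⟩ := hle hx
    obtain ⟨z, hz, hzγ⟩ := h t ht a ha b hb d hd
    obtain ⟨x₁, hx₁, b₁, hb₁, hz'⟩ := (P.mem_ap).1 hz
    obtain rfl := Part.mem_unique hx₁ hx₀
    obtain rfl := Part.mem_some_iff.1 hb₁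
    obtain ⟨w, hw, hwz⟩ := P.app_mono hxx le_rfl z hz'
    exact ⟨w, hw, γ.lower hwz hzγ⟩

theorem mem_of_kleeneLE {x y : Part P.carrier} {γ : LowerSet P.carrier} (h : KleeneLE x y)
    (hy : ∃ z ∈ y, z ∈ γ) : ∃ z ∈ x, z ∈ γ := by
  obtain ⟨z, hz, hzγ⟩ := hy
  obtain ⟨w, hw, hwz⟩ := h z hz
  exact ⟨w, hw, γ.lower hwz hzγ⟩

/-- The PCA `DP` of downsets of a PCA `P`, ordered by inclusion; its filter consists of the
downsets that contain an element of the filter of `P`. -/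
abbrev down : PCA.{u} where
  toPartialApplicativePoset := P.downPoset
  filter := {α : LowerSet P.carrier | ∃ a ∈ P.filter, a ∈ α}
  filter_up := by
    rintro α β ⟨a, ha, haα⟩ h
    exact ⟨a, ha, h haα⟩
  filter_app := by
    rintro α β γ ⟨a, ha, haα⟩ ⟨b, hb, hbβ⟩ hγ
    obtain ⟨z, hz, hzγ⟩ := P.mem_of_downApp hγ haα hbβ
    exact ⟨z, P.filter_app ha hb hz, hzγ⟩
  exists_k := by
    obtain ⟨k, hk, h⟩ := P.exists_k
    refine ⟨LowerSet.Iic k, ⟨k, hk, le_rfl⟩, fun α β => ?_⟩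
    have h' : ∀ t ≤ k, ∀ a b, KleeneLE (P.ap (P.ap (Part.some t) (Part.some a)) (Part.some b))
        (Part.some a) := fun t ht a b =>
      (P.ap_mono (P.ap_mono (kleeneLE_some_some ht) (KleeneLE.refl _)) (KleeneLE.refl _)).trans
        (h a b)
    refine (P.down_ap₂).2 ⟨fun t ht a ha => ?_, fun t ht a ha b hb => ?_⟩
    · obtain ⟨c, hc, -⟩ := kleeneLE_some.1 (h' t ht a a)
      obtain ⟨d, hd, -⟩ := (P.mem_ap).1 hc
      exact Part.dom_iff_mem.2 ⟨d, hd⟩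
    · exact P.mem_of_kleeneLE (h' t ht a b) ⟨a, Part.mem_some _, ha⟩
  exists_s := by
    obtain ⟨s, hs, h⟩ := P.exists_s
    have hmono : ∀ t ≤ s, ∀ a b,
        KleeneLE (P.ap (P.ap (Part.some t) (Part.some a)) (Part.some b))
          (P.ap (P.ap (Part.some s) (Part.some a)) (Part.some b)) := fun t ht a b =>
      P.ap_mono (P.ap_mono (kleeneLE_some_some ht) (KleeneLE.refl _)) (KleeneLE.refl _)
    have hd : ∀ t ≤ s, ∀ a b,
        ∃ z, z ∈ P.ap (P.ap (Part.some t) (Part.some a)) (Part.some b) := by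
      intro t ht a b
      obtain ⟨z, hz⟩ := Part.dom_iff_mem.1 (h a b).1
      obtain ⟨w, hw, -⟩ := hmono t ht a b z hz
      exact ⟨w, hw⟩
    refine ⟨LowerSet.Iic s, ⟨s, hs, le_rfl⟩, fun α β => ?_⟩
    have hdom : (P.downPoset.ap (P.downPoset.ap (Part.some (LowerSet.Iic s)) (Part.some α))
        (Part.some β)).Dom := by
      have : KleeneLE (P.downPoset.ap (P.downPoset.ap (Part.some (LowerSet.Iic s))
          (Part.some α)) (Part.some β)) (Part.some (⊤ : LowerSet P.carrier)) := by
        refine (P.down_ap₂).2 ⟨fun t ht a ha => ?_, fun t ht a ha b hb => ?_⟩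
        · obtain ⟨c, hc⟩ := hd t ht a a
          obtain ⟨d, hd, -⟩ := (P.mem_ap).1 hc
          exact Part.dom_iff_mem.2 ⟨d, hd⟩
        · obtain ⟨z, hz⟩ := hd t ht a b
          exact ⟨z, hz, trivial⟩
      obtain ⟨δ, hδ, -⟩ := kleeneLE_some.1 this
      exact Part.dom_iff_mem.2 ⟨δ, hδ⟩
    refine ⟨hdom, fun γ δ hδ => ?_⟩
    rw [← kleeneLE_some]
    refine (P.down_ap₃).2 ⟨hdom, fun t ht a ha b hb c hc => ?_⟩
    obtain ⟨ζ, hζ, hδ⟩ := Part.mem_bind_iff.1 hδ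
    obtain ⟨η, hη, hδ⟩ := Part.mem_bind_iff.1 hδ
    have hζ' : ζ ∈ P.downApp α γ := by
      simpa [PartialApplicativePoset.ap, downPoset] using hζ
    have hη' : η ∈ P.downApp β γ := by
      simpa [PartialApplicativePoset.ap, downPoset] using hη
    obtain ⟨x, hx, hxζ⟩ := P.mem_of_downApp hζ' ha hc
    obtain ⟨y, hy, hyη⟩ := P.mem_of_downApp hη' hb hc
    obtain ⟨z, hz, hzδ⟩ := P.mem_of_downApp hδ hxζ hyη
    refine P.mem_of_kleeneLE ((P.ap_mono (hmono t ht a b) (KleeneLE.refl _)).trans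
      ((h a b).2 c)) ⟨z, ?_, hzδ⟩
    exact (P.mem_ap).2 ⟨x, (P.mem_ap_some).2 hx, y, (P.mem_ap_some).2 hy, hz⟩

end PCA

/-! ### Locally preordered bicategories

A bicategory whose hom-categories are preorders is given by objects, preorders of 1-cells, and
monotone composition that is unital and associative up to isomorphism; the coherence laws hold
automatically. -/

/-- The data of a bicategory whose hom-categories are preorders. -/
class PreorderBicategory (C : Type u) extends CategoryStruct.{v} C where
  homPreorder : ∀ X Y : C, Preorder (X ⟶ Y)
  comp_mono : ∀ {X Y Z : C} {f f' : X ⟶ Y} {g g' : Y ⟶ Z}, f ≤ f' → g ≤ g' → f ≫ g ≤ f' ≫ g'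
  id_comp_le : ∀ {X Y : C} (f : X ⟶ Y), 𝟙 X ≫ f ≤ f
  le_id_comp : ∀ {X Y : C} (f : X ⟶ Y), f ≤ 𝟙 X ≫ f
  comp_id_le : ∀ {X Y : C} (f : X ⟶ Y), f ≫ 𝟙 Y ≤ f
  le_comp_id : ∀ {X Y : C} (f : X ⟶ Y), f ≤ f ≫ 𝟙 Y
  assoc_le : ∀ {X Y Z W : C} (f : X ⟶ Y) (g : Y ⟶ Z) (h : Z ⟶ W), (f ≫ g) ≫ h ≤ f ≫ g ≫ h
  le_assoc : ∀ {X Y Z W : C} (f : X ⟶ Y) (g : Y ⟶ Z) (h : Z ⟶ W), f ≫ g ≫ h ≤ (f ≫ g) ≫ h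

attribute [reducible, instance] PreorderBicategory.homPreorder

/-- The bicategory given by such data: there is a unique 2-cell `f ⟶ g` when `f ≤ g`, and
none otherwise. -/
instance PreorderBicategory.bicategory (C : Type u) [PreorderBicategory.{u, v} C] :
    Bicategory.{v, v} C where
  homCategory _ _ := Preorder.smallCategory _
  whiskerLeft f _ _ η := homOfLE (comp_mono (le_refl f) (leOfHom η))
  whiskerRight η h := homOfLE (comp_mono (leOfHom η) (le_refl h))
  associator f g h := ⟨homOfLE (assoc_le f g h), homOfLE (le_assoc f g h),
    Subsingleton.elim _ _, Subsingleton.elim _ _⟩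
  leftUnitor f := ⟨homOfLE (id_comp_le f), homOfLE (le_id_comp f),
    Subsingleton.elim _ _, Subsingleton.elim _ _⟩
  rightUnitor f := ⟨homOfLE (comp_id_le f), homOfLE (le_comp_id f),
    Subsingleton.elim _ _, Subsingleton.elim _ _⟩
  whiskerLeft_id _ _ := Subsingleton.elim _ _
  whiskerLeft_comp _ _ _ _ _ _ := Subsingleton.elim _ _
  id_whiskerLeft _ := Subsingleton.elim _ _
  comp_whiskerLeft _ _ _ _ _ := Subsingleton.elim _ _
  id_whiskerRight _ _ := Subsingleton.elim _ _
  comp_whiskerRight _ _ _ := Subsingleton.elim _ _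
  whiskerRight_id _ := Subsingleton.elim _ _
  whiskerRight_comp _ _ _ := Subsingleton.elim _ _
  whisker_assoc _ _ _ _ _ := Subsingleton.elim _ _
  whisker_exchange _ _ := Subsingleton.elim _ _
  pentagon _ _ _ _ := Subsingleton.elim _ _
  triangle _ _ := Subsingleton.elim _ _

/-- A class of 1-cells that contains the identities and is closed under composition. -/
structure WideClass (C : Type u) [PreorderBicategory.{u, v} C] where
  mem : ∀ {X Y : C}, (X ⟶ Y) → Prop
  id_mem : ∀ X : C, mem (𝟙 X)
  comp_mem : ∀ {X Y Z : C} {f : X ⟶ Y} {g : Y ⟶ Z}, mem f → mem g → mem (f ≫ g)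

/-- The wide sub-bicategory on a class of 1-cells: the same objects, the 1-cells of the class,
and all 2-cells between them. -/
@[ext] structure Wide {C : Type u} [PreorderBicategory.{u, v} C] (W : WideClass C) : Type u where
  obj : C

/-- The 1-cells of the wide sub-bicategory. -/
@[ext] structure Wide.Hom {C : Type u} [PreorderBicategory.{u, v} C] {W : WideClass C}
    (X Y : Wide W) : Type v where
  hom : X.obj ⟶ Y.obj
  mem : W.mem hom

instance Wide.preorderBicategory {C : Type u} [PreorderBicategory.{u, v} C] (W : WideClass C) :
    PreorderBicategory.{u, v} (Wide W) where
  Hom := Wide.Hom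
  id X := ⟨𝟙 X.obj, W.id_mem X.obj⟩
  comp f g := ⟨f.hom ≫ g.hom, W.comp_mem f.mem g.mem⟩
  homPreorder _ _ := Preorder.lift Wide.Hom.hom
  comp_mono h h' := PreorderBicategory.comp_mono (C := C) h h'
  id_comp_le f := PreorderBicategory.id_comp_le f.hom
  le_id_comp f := PreorderBicategory.le_id_comp f.hom
  comp_id_le f := PreorderBicategory.comp_id_le f.hom
  le_comp_id f := PreorderBicategory.le_comp_id f.hom
  assoc_le f g h := PreorderBicategory.assoc_le f.hom g.hom h.hom
  le_assoc f g h := PreorderBicategory.le_assoc f.hom g.hom h.hom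

/-- A 2-functor between locally preordered bicategories, from a strictly functorial and locally
monotone assignment. -/
def mkTwoFunctor {C D : Type u} [PreorderBicategory.{u, v} C] [PreorderBicategory.{u, v} D]
    (obj : C → D) (map : ∀ {X Y : C}, (X ⟶ Y) → (obj X ⟶ obj Y))
    (mono : ∀ {X Y : C} {f g : X ⟶ Y}, f ≤ g → map f ≤ map g)
    (map_id : ∀ X : C, map (𝟙 X) = 𝟙 (obj X))
    (map_comp : ∀ {X Y Z : C} (f : X ⟶ Y) (g : Y ⟶ Z), map (f ≫ g) = map f ≫ map g) :
    StrictPseudofunctor C D :=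
  StrictPseudofunctor.mk'
    { obj := obj
      map := map
      map₂ := fun η => homOfLE (mono (leOfHom η))
      map₂_id := fun _ => Subsingleton.elim _ _
      map₂_comp := fun _ _ => Subsingleton.elim _ _
      map_id := map_id
      map_comp := map_comp
      map₂_whisker_left := fun _ _ _ _ => Subsingleton.elim _ _
      map₂_whisker_right := fun _ _ => Subsingleton.elim _ _
      map₂_left_unitor := fun _ => Subsingleton.elim _ _
      map₂_right_unitor := fun _ => Subsingleton.elim _ _
      map₂_associator := fun _ _ _ => Subsingleton.elim _ _ }

/-- The inclusion of a wide sub-bicategory. -/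
def Wide.incl {C : Type u} [PreorderBicategory.{u, v} C] (W : WideClass C) :
    StrictPseudofunctor (Wide W) C :=
  mkTwoFunctor Wide.obj Wide.Hom.hom (fun h => h) (fun _ => rfl) (fun _ _ => rfl)

/-- A 2-functor all of whose values on 1-cells lie in a class `W`, as a 2-functor into the wide
sub-bicategory on `W`. -/
def corestrict {C D : Type u} [PreorderBicategory.{u, v} C] [PreorderBicategory.{u, v} D]
    (F : StrictPseudofunctor C D) (W : WideClass D)
    (h : ∀ {X Y : C} (f : X ⟶ Y), W.mem (F.map f)) : StrictPseudofunctor C (Wide W) :=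
  mkTwoFunctor (fun X => ⟨F.obj X⟩) (fun f => ⟨F.map f, h f⟩)
    (fun hfg => leOfHom (F.map₂ (homOfLE hfg)))
    (fun X => Wide.Hom.ext (F.map_id X)) (fun f g => Wide.Hom.ext (F.map_comp f g))

/-- A 2-functor is 2-fully faithful if it is an equivalence on all hom-categories. -/
def TwoFullyFaithful {C D : Type u} [PreorderBicategory.{u, v} C] [PreorderBicategory.{u, v} D]
    (F : StrictPseudofunctor C D) : Prop :=
  ∀ X Y : C, (F.mapFunctor X Y).IsEquivalence

/-! ### Morphisms of PCAs -/

/-- A morphism of PCAs. -/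
@[ext] structure PCA.Hom (A B : PCA.{u}) : Type u where
  toFun : A.carrier → B.carrier
  map_filter : ∀ a ∈ A.filter, toFun a ∈ B.filter
  map_app : ∃ t ∈ B.filter, ∀ a a' c : A.carrier, c ∈ A.app a a' →
    KleeneLE (B.ap (B.ap (Part.some t) (Part.some (toFun a))) (Part.some (toFun a')))
      (Part.some (toFun c))
  map_le : ∃ v ∈ B.filter, ∀ a a' : A.carrier, a ≤ a' →
    KleeneLE (B.ap (Part.some v) (Part.some (toFun a))) (Part.some (toFun a'))

namespace PCA

/-- The order up to a realizer on morphisms of PCAs. -/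
instance Hom.preorder (A B : PCA.{u}) : Preorder (Hom A B) where
  le f g := ∃ s ∈ B.filter, ∀ a, KleeneLE (B.ap (Part.some s) (Part.some (f.toFun a)))
    (Part.some (g.toFun a))
  le_refl f := by
    obtain ⟨i, hi, h⟩ := B.exists_i
    exact ⟨i, hi, fun a => h _⟩
  le_trans f g h := by
    rintro ⟨s, hs, h₁⟩ ⟨s', hs', h₂⟩
    obtain ⟨r, hr, z, -, h₃⟩ := B.exists_lam₁ (.app (.const s') (.app (.const s) (.var 0)))
      ⟨hs', hs, trivial⟩
    exact ⟨r, hr, fun a => (h₃ _).trans ((B.ap_mono (KleeneLE.refl _) (h₁ a)).trans (h₂ a))⟩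

/-- A morphism of PCAs `f` is computationally dense if there is `m` in the filter such that
for all `s` in the filter there is `r` in the filter with `m f(r a) ≤ s f(a)`, as a Kleene
inequality, for all `a`. -/
def Hom.CompDense {A B : PCA.{u}} (f : Hom A B) : Prop :=
  ∃ m ∈ B.filter, ∀ s ∈ B.filter, ∃ r ∈ A.filter, ∀ a : A.carrier,
    KleeneLE (B.ap (Part.some m) ((A.app r a).map f.toFun))
      (B.ap (Part.some s) (Part.some (f.toFun a)))

/-- Composition of morphisms of PCAs. -/
def Hom.comp {A B C : PCA.{u}} (f : Hom A B) (g : Hom B C) : Hom A C where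
  toFun := g.toFun ∘ f.toFun
  map_filter a ha := g.map_filter _ (f.map_filter a ha)
  map_app := by
    obtain ⟨t, ht, h⟩ := f.map_app
    obtain ⟨t', ht', h'⟩ := g.map_app
    obtain ⟨v, hv, hv'⟩ := g.map_le
    obtain ⟨r, hr, z, -, h₃⟩ := C.exists_lam₂ (.app (.const v) (.app (.app (.const t')
      (.app (.app (.const t') (.const (g.toFun t))) (.var 1))) (.var 0)))
      ⟨hv, ⟨ht', ⟨ht', g.map_filter t ht⟩, trivial⟩, trivial⟩
    refine ⟨r, hr, fun a a' c hc => ((h₃ _).2 _).trans ?_⟩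
    obtain ⟨x, hx, hxc⟩ := kleeneLE_some.1 (h a a' c hc)
    obtain ⟨y, hy, hx⟩ := (B.mem_ap).1 hx
    obtain ⟨w, hw, hx⟩ := hx
    obtain rfl := Part.mem_some_iff.1 hw
    have h₄ := h' _ _ _ ((B.mem_ap_some).1 hy)
    refine KleeneLE.trans ?_ (hv' x _ hxc)
    exact C.ap_mono (KleeneLE.refl _)
      ((C.ap_mono (C.ap_mono (KleeneLE.refl _) h₄) (KleeneLE.refl _)).trans (h' _ _ _ hx))
  map_le := by
    obtain ⟨v, hv, h⟩ := f.map_le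
    obtain ⟨t', ht', h'⟩ := g.map_app
    obtain ⟨v', hv', h''⟩ := g.map_le
    obtain ⟨r, hr, z, -, h₃⟩ := C.exists_lam₁ (.app (.const v') (.app (.app (.const t')
      (.const (g.toFun v))) (.var 0))) ⟨hv', ⟨ht', g.map_filter v hv⟩, trivial⟩
    refine ⟨r, hr, fun a a' hle => (h₃ _).trans ?_⟩
    obtain ⟨x, hx, hxc⟩ := kleeneLE_some.1 (h a a' hle)
    exact (C.ap_mono (KleeneLE.refl _) (h' _ _ _ ((B.mem_ap_some).1 hx))).trans (h'' _ _ hxc)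

theorem Hom.comp_le_comp {A B C : PCA.{u}} {f f' : Hom A B} {g g' : Hom B C}
    (hf : f ≤ f') (hg : g ≤ g') : f.comp g ≤ f'.comp g' := by
  have h1 : f.comp g ≤ f'.comp g := by
    obtain ⟨s, hs, h⟩ := hf
    obtain ⟨t, ht, h'⟩ := g.map_app
    obtain ⟨v, hv, h''⟩ := g.map_le
    obtain ⟨r, hr, z, -, h₃⟩ := C.exists_lam₁ (.app (.const v) (.app (.app (.const t)
      (.const (g.toFun s))) (.var 0))) ⟨hv, ⟨ht, g.map_filter s hs⟩, trivial⟩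
    refine ⟨r, hr, fun a => (h₃ _).trans ?_⟩
    obtain ⟨x, hx, hxc⟩ := kleeneLE_some.1 (h a)
    exact (C.ap_mono (KleeneLE.refl _) (h' _ _ _ ((B.mem_ap_some).1 hx))).trans (h'' _ _ hxc)
  refine h1.trans ?_
  obtain ⟨s, hs, h⟩ := hg
  exact ⟨s, hs, fun a => h _⟩

/-- The unit `δ`, sending an element to its principal downset. -/
def unit (A : PCA.{u}) : Hom A A.down where
  toFun := LowerSet.Iic
  map_filter a ha := ⟨a, ha, le_rfl⟩
  map_app := by
    obtain ⟨i, hi, h⟩ := A.down.exists_i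
    refine ⟨i, hi, fun a a' c hc => (A.down.ap_mono (h _) (KleeneLE.refl _)).trans ?_⟩
    refine (A.down_ap₁).2 fun x hx y hy => ?_
    obtain ⟨z, hz, hzc⟩ := A.app_mono hx hy c hc
    exact ⟨z, (A.mem_ap_some).2 hz, hzc⟩
  map_le := by
    obtain ⟨i, hi, h⟩ := A.down.exists_i
    exact ⟨i, hi, fun a a' hle => (h _).trans (kleeneLE_some_some (LowerSet.Iic_le.2 hle))⟩

theorem mem_biSup {A B : PCA.{u}} {f : A.carrier → LowerSet B.carrier}
    {α : LowerSet A.carrier} {b : B.carrier} :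
    b ∈ (⨆ a ∈ α, f a) ↔ ∃ a ∈ α, b ∈ f a := by
  simp [LowerSet.mem_iSup_iff]

/-- The union extension of a morphism `f : A → DB`, sending `α` to the union of the `f a`
for `a ∈ α`. -/
def unionExt {A B : PCA.{u}} (f : Hom A B.down) : Hom A.down B.down where
  toFun α := ⨆ a ∈ (α : LowerSet A.carrier), f.toFun a
  map_filter := by
    rintro α ⟨a, ha, haα⟩
    obtain ⟨b, hb, hbf⟩ := f.map_filter a ha
    exact ⟨b, hb, mem_biSup.2 ⟨a, haα, hbf⟩⟩
  map_app := by
    obtain ⟨t, ht, h⟩ := f.map_app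
    obtain ⟨r, hr, z, -, h₃⟩ := B.down.exists_lam₂
      (.app (.app (.const t) (.var 1)) (.var 0)) ⟨⟨ht, trivial⟩, trivial⟩
    refine ⟨r, hr, fun α α' γ hγ => (B.down_ap₂).2 ⟨fun ρ hρ x hx => ?_,
      fun ρ hρ x hx y hy => ?_⟩⟩
    · obtain ⟨δ, hδ⟩ := Part.dom_iff_mem.1 (h₃ (⨆ a ∈ (α : LowerSet A.carrier), f.toFun a)).1
      obtain ⟨w, hw, -⟩ := (B.down_ap₁).1 (kleeneLE_some.2 ⟨δ, hδ, le_rfl⟩) ρ hρ x hx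
      exact Part.dom_iff_mem.2 ⟨w, hw⟩
    · obtain ⟨a, ha, hxa⟩ := mem_biSup.1 hx
      obtain ⟨a', ha', hya⟩ := mem_biSup.1 hy
      obtain ⟨c, hc, hcγ⟩ := A.mem_of_downApp hγ ha ha'
      obtain ⟨w, hw, hwc⟩ := ((B.down_ap₂).1 (((h₃ _).2 _).trans (h a a' c hc))).2
        ρ hρ x hxa y hya
      exact ⟨w, hw, mem_biSup.2 ⟨c, hcγ, hwc⟩⟩
  map_le := by
    obtain ⟨i, hi, h⟩ := B.down.exists_i
    exact ⟨i, hi, fun a a' hle => (h _).trans (kleeneLE_some_some (biSup_mono hle))⟩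

theorem mem_unionExt {A B : PCA.{u}} {f : Hom A B.down} {α : LowerSet A.carrier}
    {b : B.carrier} :
    b ∈ (show LowerSet B.carrier from (unionExt f).toFun α) ↔
      ∃ a ∈ α, b ∈ (show LowerSet B.carrier from f.toFun a) :=
  mem_biSup

theorem unionExt_mono {A B : PCA.{u}} {f g : Hom A B.down} (h : f ≤ g) :
    unionExt f ≤ unionExt g := by
  obtain ⟨s, hs, h⟩ := h
  refine ⟨s, hs, fun α => (B.down_ap₁).2 fun t ht b hb => ?_⟩
  obtain ⟨a, ha, hba⟩ := mem_unionExt.1 hb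
  obtain ⟨z, hz, hza⟩ := (B.down_ap₁).1 (h a) t ht b hba
  exact ⟨z, hz, mem_unionExt.2 ⟨a, ha, hza⟩⟩

theorem unionExt_unit (A : PCA.{u}) (α : LowerSet A.carrier) :
    (unionExt (unit A)).toFun α = α := by
  apply LowerSet.ext
  ext b
  refine (mem_unionExt (f := unit A)).trans ⟨?_, fun h => ⟨b, h, le_rfl⟩⟩
  rintro ⟨a, ha, hba⟩
  exact α.lower hba ha

theorem unionExt_comp {A B C : PCA.{u}} (f : Hom A B.down) (g : Hom B C.down)
    (α : LowerSet A.carrier) :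
    (unionExt (f.comp (unionExt g))).toFun α = (unionExt g).toFun ((unionExt f).toFun α) := by
  apply LowerSet.ext
  ext c
  refine (mem_unionExt (f := f.comp (unionExt g))).trans (Iff.trans ?_ mem_unionExt.symm)
  constructor
  · rintro ⟨a, ha, hc⟩
    obtain ⟨b, hb, hc⟩ := mem_unionExt.1 hc
    exact ⟨b, mem_unionExt.2 ⟨a, ha, hb⟩, hc⟩
  · rintro ⟨b, hb, hc⟩
    obtain ⟨a, ha, hb⟩ := mem_unionExt.1 hb
    exact ⟨a, ha, mem_unionExt.2 ⟨b, hb, hc⟩⟩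

theorem compDense_unit (A : PCA.{u}) : (unit A).CompDense := by
  obtain ⟨i, hi, h⟩ := A.down.exists_i
  refine ⟨i, hi, ?_⟩
  rintro σ ⟨r, hr, hrσ⟩
  refine ⟨r, hr, fun a δ hδ => ?_⟩
  rw [← kleeneLE_some]
  obtain ⟨z, hz, hzδ⟩ := (A.down_ap₁).1 (kleeneLE_some.2 ⟨δ, hδ, le_rfl⟩) r hrσ a le_rfl
  rw [Part.eq_some_iff.2 ((A.mem_ap_some).1 hz), Part.map_some]
  exact (h _).trans (kleeneLE_some_some (LowerSet.Iic_le.2 hzδ))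

theorem compDense_comp {A B C : PCA.{u}} {f : Hom A B.down} {g : Hom B C.down}
    (hf : f.CompDense) (hg : g.CompDense) : (f.comp (unionExt g)).CompDense := by
  obtain ⟨μ, ⟨m, hm, hmμ⟩, hμ⟩ := hf
  obtain ⟨ν, hν, hg⟩ := hg
  obtain ⟨t, ht, h'⟩ := g.map_app
  obtain ⟨v, hv, h''⟩ := g.map_le
  obtain ⟨q, hq, z, -, h₃⟩ := C.down.exists_lam₁ (.app (.const ν) (.app (.const v)
    (.app (.app (.const t) (.const (g.toFun m))) (.var 0))))
    ⟨hν, hv, ⟨ht, g.map_filter m hm⟩, trivial⟩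
  refine ⟨q, hq, fun σ hσ => ?_⟩
  obtain ⟨r₁, hr₁, h₁⟩ := hg σ hσ
  obtain ⟨r, hr, h₂⟩ := hμ (LowerSet.Iic r₁) ⟨r₁, hr₁, le_rfl⟩
  refine ⟨r, hr, fun a δ hδ => ?_⟩
  rw [← kleeneLE_some]
  have hδ' := (C.down_ap₁).1 (kleeneLE_some.2 ⟨δ, hδ, le_rfl⟩)
  have key : ∀ b ∈ (show LowerSet B.carrier from f.toFun a), ∃ w ∈ B.app r₁ b,
      KleeneLE (C.down.ap (Part.some ν) (Part.some (g.toFun w))) (Part.some δ) := by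
    intro b hb
    have h4 : KleeneLE (C.down.ap (Part.some σ) (Part.some (g.toFun b))) (Part.some δ) :=
      (C.down_ap₁).2 fun x hx y hy => hδ' x hx y (mem_unionExt.2 ⟨b, hb, hy⟩)
    obtain ⟨ζ, hζ, hle⟩ := kleeneLE_some.1 ((h₁ b).trans h4)
    obtain ⟨_, hn, ω, hω, hζ'⟩ := (C.down.mem_ap).1 hζ
    obtain ⟨w, hw, rfl⟩ := (Part.mem_map_iff _).1 hω
    exact ⟨w, hw, kleeneLE_some.2 ⟨ζ, (C.down.mem_ap).2 ⟨_, hn, _, Part.mem_some _, hζ'⟩, hle⟩⟩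
  have h5 : KleeneLE (B.down.ap (Part.some (LowerSet.Iic r₁)) (Part.some (f.toFun a)))
      (Part.some (lowerClosure {w | ∃ b ∈ (show LowerSet B.carrier from f.toFun a),
        w ∈ B.app r₁ b})) := by
    refine (B.down_ap₁).2 fun x hx b hb => ?_
    obtain ⟨w, hw, -⟩ := key b hb
    obtain ⟨w', hw', hle⟩ := B.app_mono hx le_rfl w hw
    exact ⟨w', (B.mem_ap_some).2 hw', w, ⟨b, hb, hw⟩, hle⟩
  obtain ⟨ζ, hζ, hle⟩ := kleeneLE_some.1 ((h₂ a).trans h5)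
  obtain ⟨_, hn, ω, hω, hζ'⟩ := (B.down.mem_ap).1 hζ
  obtain rfl := Part.mem_some_iff.1 hn
  obtain ⟨x, hx, rfl⟩ := (Part.mem_map_iff _).1 hω
  rw [Part.eq_some_iff.2 hx, Part.map_some]
  refine (C.down_ap₁).2 fun κ hκ y hy => ?_
  obtain ⟨b', hb', hyb⟩ := mem_unionExt.1 hy
  obtain ⟨w, hw, hwζ⟩ := B.mem_of_downApp hζ' hmμ hb'
  obtain ⟨w₁, ⟨b, hb, hw₁⟩, hww⟩ := hle hwζ
  obtain ⟨w₂, hw₂, h6⟩ := key b hb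
  obtain rfl := Part.mem_unique hw₂ hw₁
  have h7 := (h₃ (g.toFun b')).trans ((C.down.ap_mono (KleeneLE.refl _)
    ((C.down.ap_mono (KleeneLE.refl _) (h' m b' w hw)).trans (h'' w w₂ hww))).trans h6)
  exact (C.down_ap₁).1 h7 κ hκ y hyb

end PCA

/-! ### The bicategory of PCAs and partial applicative morphisms -/

/-- An object of the bicategory of PCAs and partial applicative morphisms. -/
structure OPCAD : Type (u + 1) where
  pca : PCA.{u}

/-- A 1-cell `A ⟶ B`, called a partial applicative morphism, is a morphism of PCAs `A → DB`.
The identity is the unit, and the composite of `f : A → DB` and `g : B → DC` is the Kleisli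
composite, sending `a` to the union of the `g b` for `b ∈ f a`. -/
instance : PreorderBicategory.{u + 1, u} OPCAD.{u} where
  Hom A B := PCA.Hom A.pca B.pca.down
  id A := PCA.unit A.pca
  comp f g := f.comp (PCA.unionExt g)
  homPreorder A B := PCA.Hom.preorder A.pca B.pca.down
  comp_mono hf hg := PCA.Hom.comp_le_comp hf (PCA.unionExt_mono hg)
  id_comp_le {A B} f := by
    obtain ⟨v, hv, h⟩ := f.map_le
    refine ⟨v, hv, fun a => (B.pca.down_ap₁).2 fun x hx b hb => ?_⟩
    obtain ⟨a', ha', hb⟩ := PCA.mem_unionExt.1 hb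
    exact (B.pca.down_ap₁).1 (h a' a ha') x hx b hb
  le_id_comp {A B} f := by
    obtain ⟨i, hi, h⟩ := B.pca.down.exists_i
    refine ⟨i, hi, fun a => (h _).trans (kleeneLE_some_some fun b hb => ?_)⟩
    exact PCA.mem_unionExt.2 ⟨a, le_rfl, hb⟩
  comp_id_le f := le_of_eq (PCA.Hom.ext (funext fun a => PCA.unionExt_unit _ _))
  le_comp_id f := le_of_eq (PCA.Hom.ext (funext fun a => (PCA.unionExt_unit _ _).symm))
  assoc_le f g h := le_of_eq (PCA.Hom.ext (funext fun a => (PCA.unionExt_comp g h _).symm))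
  le_assoc f g h := le_of_eq (PCA.Hom.ext (funext fun a => PCA.unionExt_comp g h _))

/-- The class of computationally dense partial applicative morphisms. -/
def OPCAD.compDense : WideClass OPCAD.{u} where
  mem f := PCA.Hom.CompDense f
  id_mem A := PCA.compDense_unit A.pca
  comp_mem hf hg := PCA.compDense_comp hf hg

/-! ### Arrow algebras -/

/-- An arrow algebra: a complete lattice with a monotone implication and a separator. (A complete
meet-semilattice is the same thing as a complete lattice.) -/
structure ArrAlg : Type (u + 1) where
  carrier : Type u
  [lattice : CompleteLattice carrier]
  imp : carrier → carrier → carrier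
  imp_mono : ∀ {a a' b b' : carrier}, a' ≤ a → b ≤ b' → imp a b ≤ imp a' b'
  sep : Set carrier
  sep_up : ∀ {a b : carrier}, a ∈ sep → a ≤ b → b ∈ sep
  sep_mp : ∀ {a b : carrier}, imp a b ∈ sep → a ∈ sep → b ∈ sep
  sep_k : (⨅ (a : carrier) (b : carrier), imp a (imp b a)) ∈ sep
  sep_s : (⨅ (a : carrier) (b : carrier) (c : carrier),
    imp (imp a (imp b c)) (imp (imp a b) (imp a c))) ∈ sep
  sep_a : (⨅ (a : carrier) (I : Type u) (b : I → carrier) (c : I → carrier),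
    imp (⨅ i, imp a (imp (b i) (c i))) (imp a (⨅ i, imp (b i) (c i)))) ∈ sep

attribute [instance] ArrAlg.lattice

namespace ArrAlg

/-- The logical order on families: `φ ⊢ ψ` if the meet of all `φ i → ψ i` is in the separator. -/
def Entails (A : ArrAlg.{u}) {I : Type u} (φ ψ : I → A.carrier) : Prop :=
  (⨅ i, A.imp (φ i) (ψ i)) ∈ A.sep

/-- The operation `∂ a = ⊤ → a`. -/
def del (A : ArrAlg.{u}) (a : A.carrier) : A.carrier := A.imp ⊤ a

/-- Existential quantification along a function `g : X → Y`, in the arrow tripos. -/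
def ex (A : ArrAlg.{u}) {X Y : Type u} (g : X → Y) (α : X → A.carrier) : Y → A.carrier := fun y =>
  ⨅ a : A.carrier, A.imp (⨅ (x : X) (_ : g x = y), A.imp (α x) (A.del a)) (A.del (A.del a))

/-- An implicative morphism of arrow algebras. -/
@[ext] structure Hom (A B : ArrAlg.{u}) : Type u where
  toFun : A.carrier → B.carrier
  map_sep : ∀ a ∈ A.sep, toFun a ∈ B.sep
  map_imp : ∃ r ∈ B.sep, ∀ a a' : A.carrier,
    r ≤ B.imp (toFun (A.imp a a')) (B.imp (toFun a) (toFun a'))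
  map_iInf : ∀ X : Set (A.carrier × A.carrier),
    (⨅ p ∈ X, A.imp p.1 p.2) ∈ A.sep → (⨅ p ∈ X, B.imp (toFun p.1) (toFun p.2)) ∈ B.sep

section

variable {A B C : ArrAlg.{u}} {I : Type u}

theorem mp_family {x y z : I → A.carrier} (h : (⨅ i, A.imp (x i) (A.imp (y i) (z i))) ∈ A.sep)
    (hx : (⨅ i, x i) ∈ A.sep) : (⨅ i, A.imp (y i) (z i)) ∈ A.sep := by
  have h1 : (⨅ i, A.imp (⨅ i, x i) (A.imp (y i) (z i))) ∈ A.sep :=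
    A.sep_up h (iInf_mono fun i => A.imp_mono (iInf_le _ i) le_rfl)
  refine A.sep_mp (A.sep_mp (A.sep_up A.sep_a ?_) h1) hx
  exact (iInf_le _ (⨅ i, x i)).trans ((iInf_le _ I).trans ((iInf_le _ y).trans (iInf_le _ z)))

theorem k_family (x y : I → A.carrier) : (⨅ i, A.imp (x i) (A.imp (y i) (x i))) ∈ A.sep :=
  A.sep_up A.sep_k (le_iInf fun i => (iInf_le _ (x i)).trans (iInf_le _ (y i)))

theorem s_family (x y z : I → A.carrier) :
    (⨅ i, A.imp (A.imp (x i) (A.imp (y i) (z i)))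
      (A.imp (A.imp (x i) (y i)) (A.imp (x i) (z i)))) ∈ A.sep :=
  A.sep_up A.sep_s (le_iInf fun i =>
    (iInf_le _ (x i)).trans ((iInf_le _ (y i)).trans (iInf_le _ (z i))))

theorem Entails.refl (x : I → A.carrier) : A.Entails x x :=
  mp_family (mp_family (s_family x (fun i => A.imp (x i) (x i)) x) (k_family x _)) (k_family x x)

theorem Entails.trans {x y z : I → A.carrier} (h : A.Entails x y) (h' : A.Entails y z) :
    A.Entails x z :=
  mp_family (mp_family (s_family x y z)
    (mp_family (k_family (fun i => A.imp (y i) (z i)) x) h')) h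

theorem Hom.map_entails (f : Hom A B) {x y : I → A.carrier} (h : A.Entails x y) :
    B.Entails (f.toFun ∘ x) (f.toFun ∘ y) := by
  have := f.map_iInf (Set.range fun i => (x i, y i)) (by rw [iInf_range]; exact h)
  rw [iInf_range] at this
  exact this

theorem exists_realizer {x : I → A.carrier} :
    (∃ r ∈ A.sep, ∀ i, r ≤ x i) ↔ (⨅ i, x i) ∈ A.sep :=
  ⟨fun ⟨_, hr, h⟩ => A.sep_up hr (le_iInf h), fun h => ⟨_, h, iInf_le _⟩⟩

end

/-- The order up to a realizer on implicative morphisms. -/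
instance Hom.preorder (A B : ArrAlg.{u}) : Preorder (Hom A B) where
  le f g := ∃ r ∈ B.sep, ∀ a, r ≤ B.imp (f.toFun a) (g.toFun a)
  le_refl f := exists_realizer.2 (Entails.refl f.toFun)
  le_trans f g h hfg hgh :=
    exists_realizer.2 (Entails.trans (exists_realizer.1 hfg) (exists_realizer.1 hgh))

theorem Hom.le_iff_entails {A B : ArrAlg.{u}} {f g : Hom A B} :
    f ≤ g ↔ B.Entails f.toFun g.toFun :=
  exists_realizer

/-- The identity implicative morphism. -/
def Hom.id (A : ArrAlg.{u}) : Hom A A where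
  toFun a := a
  map_sep _ h := h
  map_imp := by
    obtain ⟨r, hr, h⟩ := exists_realizer.2
      (Entails.refl (A := A) fun p : A.carrier × A.carrier => A.imp p.1 p.2)
    exact ⟨r, hr, fun a a' => h (a, a')⟩
  map_iInf _ h := h

/-- Composition of implicative morphisms. -/
def Hom.comp {A B C : ArrAlg.{u}} (f : Hom A B) (g : Hom B C) : Hom A C where
  toFun := g.toFun ∘ f.toFun
  map_sep a h := g.map_sep _ (f.map_sep a h)
  map_imp := by
    obtain ⟨r, hr, h⟩ := f.map_imp
    obtain ⟨r', hr', h'⟩ := g.map_imp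
    have h1 : B.Entails (fun p : A.carrier × A.carrier => f.toFun (A.imp p.1 p.2))
        (fun p => B.imp (f.toFun p.1) (f.toFun p.2)) :=
      exists_realizer.1 ⟨r, hr, fun p => h p.1 p.2⟩
    have h2 : C.Entails (fun p : A.carrier × A.carrier =>
        g.toFun (B.imp (f.toFun p.1) (f.toFun p.2)))
        (fun p => C.imp (g.toFun (f.toFun p.1)) (g.toFun (f.toFun p.2))) :=
      exists_realizer.1 ⟨r', hr', fun p => h' _ _⟩
    obtain ⟨q, hq, h3⟩ := exists_realizer.2 ((g.map_entails h1).trans h2)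
    exact ⟨q, hq, fun a a' => h3 (a, a')⟩
  map_iInf X hX := by
    have h1 := f.map_iInf X hX
    have h2 := g.map_iInf ((fun p => (f.toFun p.1, f.toFun p.2)) '' X) (by
      rw [iInf_image]
      exact h1)
    rw [iInf_image] at h2
    exact h2

/-- Arrow algebras and implicative morphisms. -/
instance : PreorderBicategory.{u + 1, u} ArrAlg.{u} where
  Hom := Hom
  id := Hom.id
  comp := Hom.comp
  homPreorder := Hom.preorder
  comp_mono {_ _ _ f f' g g'} hf hg := by
    have h1 : f.comp g ≤ f'.comp g :=
      Hom.le_iff_entails.2 (g.map_entails (Hom.le_iff_entails.1 hf))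
    refine h1.trans ?_
    obtain ⟨r, hr, h⟩ := hg
    exact ⟨r, hr, fun a => h _⟩
  id_comp_le f := le_refl (α := Hom _ _) f
  le_id_comp f := le_refl (α := Hom _ _) f
  comp_id_le f := le_refl (α := Hom _ _) f
  le_comp_id f := le_refl (α := Hom _ _) f
  assoc_le f g h := le_refl (α := Hom _ _) _
  le_assoc f g h := le_refl (α := Hom _ _) _

/-- A regular implicative morphism: it preserves existential quantification up to isomorphism. -/
def Hom.Regular {A B : ArrAlg.{u}} (f : Hom A B) : Prop :=
  ∀ (X Y : Type u) (g : X → Y) (α : X → A.carrier),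
    B.Entails (f.toFun ∘ A.ex g α) (B.ex g (f.toFun ∘ α)) ∧
    B.Entails (B.ex g (f.toFun ∘ α)) (f.toFun ∘ A.ex g α)

/-- A computationally dense implicative morphism: it has a right adjoint. -/
def Hom.CompDense {A B : ArrAlg.{u}} (f : Hom A B) : Prop :=
  ∃ h : Hom B A, h.comp f ≤ Hom.id B ∧ Hom.id A ≤ f.comp h

/-- The class of regular implicative morphisms. -/
def regular : WideClass ArrAlg.{u} where
  mem f := Hom.Regular f
  id_mem _ _ _ _ _ := ⟨Entails.refl _, Entails.refl _⟩
  comp_mem {_ _ _ _ f'} hf hf' X Y g α :=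
    ⟨(Hom.map_entails f' (hf X Y g α).1).trans (hf' X Y g _).1,
      (hf' X Y g _).2.trans (Hom.map_entails f' (hf X Y g α).2)⟩

/-- The class of computationally dense implicative morphisms. -/
def compDense : WideClass ArrAlg.{u} where
  mem f := Hom.CompDense f
  id_mem A := ⟨Hom.id A, le_refl (Hom.id A), le_refl (Hom.id A)⟩
  comp_mem {A B C f g} := by
    rintro ⟨f', h₁, h₂⟩ ⟨g', h₃, h₄⟩
    refine ⟨g'.comp f', ?_, ?_⟩
    · have := Hom.le_iff_entails.1 h₁
      refine le_trans (α := Hom C C) (b := g'.comp g) ?_ h₃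
      refine Hom.le_iff_entails.2 ?_
      refine Hom.map_entails g (x := fun c => f.toFun (f'.toFun (g'.toFun c)))
        (y := fun c => g'.toFun c) ?_
      obtain ⟨r, hr, h⟩ := h₁
      exact exists_realizer.1 ⟨r, hr, fun c => h (g'.toFun c)⟩
    · refine le_trans (α := Hom A A) (b := Hom.comp f f') h₂ ?_
      refine Hom.le_iff_entails.2 ?_
      refine Hom.map_entails f' (x := fun a => f.toFun a)
        (y := fun a => g'.toFun (g.toFun (f.toFun a))) ?_
      obtain ⟨r, hr, h⟩ := h₄
      exact exists_realizer.1 ⟨r, hr, fun a => h (f.toFun a)⟩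

end ArrAlg

/-! ### The arrow algebra of downsets of a PCA -/

namespace PCA

variable (P : PCA.{u})

/-- The implication of downsets: `α → β` consists of the `a` such that `a x` is defined and in
`β` for all `x ∈ α`. -/
def downImp (α β : LowerSet P.carrier) : LowerSet P.carrier where
  carrier := {a | ∀ x ∈ α, ∃ z ∈ P.app a x, z ∈ β}
  lower' := by
    intro a b hba ha x hx
    obtain ⟨z, hz, hzβ⟩ := ha x hx
    obtain ⟨w, hw, hwz⟩ := P.app_mono hba le_rfl z hz
    exact ⟨w, hw, β.lower hwz hzβ⟩

theorem mem_downImp {α β : LowerSet P.carrier} {a : P.carrier} :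
    a ∈ P.downImp α β ↔ ∀ x ∈ α, ∃ z ∈ P.app a x, z ∈ β := Iff.rfl

theorem mem_downImp₂ {α β γ : LowerSet P.carrier} {a : P.carrier}
    (hd : ∀ x ∈ α, (P.ap (Part.some a) (Part.some x)).Dom)
    (h : ∀ x ∈ α, ∀ y ∈ β, ∃ z ∈ P.ap (P.ap (Part.some a) (Part.some x)) (Part.some y), z ∈ γ) :
    a ∈ P.downImp α (P.downImp β γ) := by
  intro x hx
  obtain ⟨w, hw⟩ := Part.dom_iff_mem.1 (hd x hx)
  refine ⟨w, (P.mem_ap_some).1 hw, fun y hy => ?_⟩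
  obtain ⟨z, hz, hzγ⟩ := h x hx y hy
  rw [Part.eq_some_iff.2 hw] at hz
  exact ⟨z, (P.mem_ap_some).1 hz, hzγ⟩

theorem dom_left {x y : Part P.carrier} (h : (P.ap x y).Dom) : x.Dom := by
  obtain ⟨z, hz⟩ := Part.dom_iff_mem.1 h
  obtain ⟨a, ha, -⟩ := (P.mem_ap).1 hz
  exact Part.dom_iff_mem.2 ⟨a, ha⟩

/-- The arrow algebra `DP` of downsets of a PCA `P`, ordered by inclusion; its separator consists
of the downsets that contain an element of the filter of `P`. -/
abbrev downArr : ArrAlg.{u} where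
  carrier := LowerSet P.carrier
  imp := P.downImp
  imp_mono {α α' β β'} h h' a ha x hx := by
    obtain ⟨z, hz, hzβ⟩ := ha x (h hx)
    exact ⟨z, hz, h' hzβ⟩
  sep := {α : LowerSet P.carrier | ∃ a ∈ P.filter, a ∈ α}
  sep_up := by
    rintro α β ⟨a, ha, haα⟩ h
    exact ⟨a, ha, h haα⟩
  sep_mp := by
    rintro α β ⟨a, ha, haα⟩ ⟨b, hb, hbα⟩
    obtain ⟨z, hz, hzβ⟩ := haα b hbα
    exact ⟨z, P.filter_app ha hb hz, hzβ⟩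
  sep_k := by
    obtain ⟨k, hk, h⟩ := P.exists_k
    refine ⟨k, hk, ?_⟩
    simp only [LowerSet.mem_iInf_iff]
    intro α β
    refine P.mem_downImp₂ (fun x hx => ?_) fun x hx y hy => ?_
    · obtain ⟨z, hz, -⟩ := kleeneLE_some.1 (h x x)
      exact P.dom_left (Part.dom_iff_mem.2 ⟨z, hz⟩)
    · exact P.mem_of_kleeneLE (h x y) ⟨x, Part.mem_some _, hx⟩
  sep_s := by
    obtain ⟨s, hs, h⟩ := P.exists_s
    refine ⟨s, hs, ?_⟩
    simp only [LowerSet.mem_iInf_iff]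
    intro α β γ
    refine P.mem_downImp₂ (fun x hx => P.dom_left (h x x).1) fun x hx y hy => ?_
    obtain ⟨w, hw⟩ := Part.dom_iff_mem.1 (h x y).1
    refine ⟨w, hw, fun c hc => ?_⟩
    obtain ⟨p, hp, hpβ⟩ := hx c hc
    obtain ⟨q, hq, hqβ⟩ := hy c hc
    obtain ⟨z, hz, hzγ⟩ := hpβ q hqβ
    have h1 := (h x y).2 c
    rw [Part.eq_some_iff.2 hw] at h1
    obtain ⟨z', hz', hz'γ⟩ := P.mem_of_kleeneLE h1 ⟨z, (P.mem_ap).2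
      ⟨p, (P.mem_ap_some).2 hp, q, (P.mem_ap_some).2 hq, hz⟩, hzγ⟩
    exact ⟨z', (P.mem_ap_some).1 hz', hz'γ⟩
  sep_a := by
    obtain ⟨r, hr, e, -, h⟩ := P.exists_lam₃ (.app (.app (.var 2) (.var 1)) (.var 0))
      ⟨⟨trivial, trivial⟩, trivial⟩
    refine ⟨r, hr, ?_⟩
    simp only [LowerSet.mem_iInf_iff]
    intro α I β γ
    refine P.mem_downImp₂ (fun x hx => P.dom_left (h x x).1) fun x hx y hy => ?_
    obtain ⟨w, hw⟩ := Part.dom_iff_mem.1 (h x y).1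
    refine ⟨w, hw, ?_⟩
    simp only [LowerSet.mem_iInf_iff] at hx ⊢
    intro i c hc
    obtain ⟨p, hp, hpβ⟩ := hx i y hy
    obtain ⟨z, hz, hzγ⟩ := hpβ c hc
    have h1 := (h x y).2 c
    rw [Part.eq_some_iff.2 hw] at h1
    obtain ⟨z', hz', hz'γ⟩ := P.mem_of_kleeneLE h1 ⟨z, (P.mem_ap).2
      ⟨p, (P.mem_ap_some).2 hp, c, Part.mem_some _, hz⟩, hzγ⟩
    exact ⟨z', (P.mem_ap_some).1 hz', hz'γ⟩

variable {P} {Q : PCA.{u}}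

/-- A morphism of PCAs `DP → DQ` is an implicative morphism. -/
def Hom.toArr (f : Hom P.down Q.down) : ArrAlg.Hom P.downArr Q.downArr where
  toFun := f.toFun
  map_sep := f.map_filter
  map_imp := by
    obtain ⟨t, ht, h⟩ := f.map_app
    obtain ⟨v, hv, h'⟩ := f.map_le
    obtain ⟨ρ, hρ, e, -, h₃⟩ := Q.down.exists_lam₂
      (.app (.const v) (.app (.app (.const t) (.var 1)) (.var 0)))
      ⟨hv, ⟨ht, trivial⟩, trivial⟩
    refine ⟨ρ, hρ, fun α β a ha => ?_⟩
    obtain ⟨δ, hδ, hle⟩ := kleeneLE_some.1 ((P.down_ap₁ (τ := P.downImp α β) (α := α)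
      (γ := β)).2 fun x hx y hy => by simpa [mem_ap] using hx y hy)
    have h4 := (Q.down_ap₂).1 (((h₃ _).2 _).trans ((Q.down.ap_mono (KleeneLE.refl _)
      (h _ _ δ ((P.down.mem_ap_some).1 hδ))).trans (h' δ β hle)))
    exact Q.mem_downImp₂ (h4.1 a ha) (h4.2 a ha)
  map_iInf X hX := by
    obtain ⟨t, ht, h⟩ := f.map_app
    obtain ⟨v, hv, h'⟩ := f.map_le
    obtain ⟨ρ, hρ, e, -, h₃⟩ := Q.down.exists_lam₁
      (.app (.const v) (.app (.app (.const t) (.const (f.toFun (⨅ p ∈ X, P.downImp p.1 p.2))))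
        (.var 0))) ⟨hv, ⟨ht, f.map_filter _ hX⟩, trivial⟩
    refine Q.downArr.sep_up hρ (le_iInf₂ fun p hp a ha x hx => ?_)
    obtain ⟨δ, hδ, hle⟩ := kleeneLE_some.1 ((P.down_ap₁ (τ := ⨅ p ∈ X, P.downImp p.1 p.2)
      (α := p.1) (γ := p.2)).2 fun y hy z hz => by
        have := iInf₂_le (f := fun p (_ : p ∈ X) => P.downImp p.1 p.2) p hp hy z hz
        simpa [mem_ap] using this)
    have h4 := (Q.down_ap₁).1 ((h₃ _).trans ((Q.down.ap_mono (KleeneLE.refl _)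
      (h _ _ δ ((P.down.mem_ap_some).1 hδ))).trans (h' δ p.2 hle)))
    obtain ⟨z, hz, hzq⟩ := h4 a ha x hx
    exact ⟨z, (Q.mem_ap_some).1 hz, hzq⟩

theorem Hom.toArr_mono {f g : Hom P.down Q.down} (h : f ≤ g) : f.toArr ≤ g.toArr := by
  obtain ⟨s, hs, h⟩ := h
  refine ⟨s, hs, fun α a ha x hx => ?_⟩
  obtain ⟨z, hz, hzq⟩ := (Q.down_ap₁).1 (h α) a ha x hx
  exact ⟨z, (Q.mem_ap_some).1 hz, hzq⟩

end PCA

/-- The 2-functor from PCAs and partial applicative morphisms to arrow algebras and implicative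
morphisms, sending `P` to the arrow algebra `DP` and `f` to its union extension. -/
def downFunctor : StrictPseudofunctor OPCAD.{u} ArrAlg.{u} :=
  mkTwoFunctor (fun A => A.pca.downArr) (fun f => (PCA.unionExt f).toArr)
    (fun h => PCA.Hom.toArr_mono (PCA.unionExt_mono h))
    (fun A => ArrAlg.Hom.ext (funext fun α => PCA.unionExt_unit A.pca α))
    (fun f g => ArrAlg.Hom.ext (funext fun α => PCA.unionExt_comp f g α))

end RealArrow

open RealArrow

namespace RealArrow

/-! ### Equivalences of hom-preorders -/

theorem twoFullyFaithful_of {C D : Type u} [PreorderBicategory.{u, v} C]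
    [PreorderBicategory.{u, v} D] {F : StrictPseudofunctor C D}
    (reflects : ∀ {X Y : C} (f g : X ⟶ Y), F.map f ≤ F.map g → f ≤ g)
    (surj : ∀ {X Y : C} (h : F.obj X ⟶ F.obj Y), ∃ f : X ⟶ Y, F.map f ≤ h ∧ h ≤ F.map f) :
    TwoFullyFaithful F := fun _ _ =>
  { faithful := ⟨fun _ => Subsingleton.elim _ _⟩
    full := ⟨fun η => ⟨homOfLE (reflects _ _ (leOfHom η)), Subsingleton.elim _ _⟩⟩
    essSurj := ⟨fun h => by
      obtain ⟨f, h₁, h₂⟩ := surj h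
      exact ⟨f, ⟨⟨homOfLE h₁, homOfLE h₂, Subsingleton.elim _ _, Subsingleton.elim _ _⟩⟩⟩⟩ }

/-! ### Entailment in arrow algebras -/

namespace ArrAlg

variable {A B : ArrAlg.{u}} {I J : Type u}

theorem Entails.of_le {x y : I → A.carrier} (h : ∀ i, x i ≤ y i) : A.Entails x y :=
  A.sep_up (Entails.refl x) (iInf_mono fun i => A.imp_mono le_rfl (h i))

theorem Entails.reindex {x y : I → A.carrier} (h : A.Entails x y) (g : J → I) :
    A.Entails (x ∘ g) (y ∘ g) :=
  A.sep_up h (le_iInf fun j => iInf_le _ (g j))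

theorem Entails.mp {x y z : I → A.carrier} (h : A.Entails x fun i => A.imp (y i) (z i))
    (h' : A.Entails x y) : A.Entails x z :=
  mp_family (mp_family (s_family x y z) h) h'

theorem Entails.const_left {x y : I → A.carrier} (h : (⨅ i, y i) ∈ A.sep) : A.Entails x y :=
  mp_family (k_family y x) h

theorem Entails.imp_congr_right {y z w : I → A.carrier} (h : A.Entails z w) :
    A.Entails (fun i => A.imp (y i) (z i)) (fun i => A.imp (y i) (w i)) :=
  mp_family (s_family y z w) (Entails.const_left h)

theorem Hom.CompDense.congr {f g : Hom A B} (hf : f.CompDense) (hfg : f ≤ g) (hgf : g ≤ f) :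
    g.CompDense := by
  obtain ⟨h, h₁, h₂⟩ := hf
  refine ⟨h, Hom.le_iff_entails.2 ?_, Hom.le_iff_entails.2 ?_⟩
  · exact ((Hom.le_iff_entails.1 hgf).reindex h.toFun).trans (Hom.le_iff_entails.1 h₁)
  · exact (Hom.le_iff_entails.1 h₂).trans (h.map_entails (Hom.le_iff_entails.1 hfg))

end ArrAlg

namespace PCA

open ArrAlg

/-! ### Realizers -/

section

variable {P : PCA.{u}} {I X Y : Type u}

theorem entails_iff {φ ψ : I → LowerSet P.carrier} :
    P.downArr.Entails φ ψ ↔ ∃ r ∈ P.filter, ∀ i, r ∈ P.downImp (φ i) (ψ i) := by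
  refine exists_congr fun r => and_congr_right fun _ => ?_
  exact LowerSet.mem_iInf_iff

theorem kleeneLE_of_mem_downImp {α β : LowerSet P.carrier} {r : P.carrier}
    (h : r ∈ P.downImp α β) :
    KleeneLE (P.down.ap (Part.some (LowerSet.Iic r)) (Part.some α)) (Part.some β) :=
  (P.down_ap₁).2 fun s hs a ha => by
    obtain ⟨z, hz, hzβ⟩ := (P.downImp α β).lower hs h a ha
    exact ⟨z, (P.mem_ap_some).2 hz, hzβ⟩

theorem mem_downImp_of_kleeneLE {τ α β : LowerSet P.carrier} {r : P.carrier} (hr : r ∈ τ)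
    (h : KleeneLE (P.down.ap (Part.some τ) (Part.some α)) (Part.some β)) :
    r ∈ P.downImp α β := fun a ha => by
  obtain ⟨z, hz, hzβ⟩ := (P.down_ap₁).1 h r hr a ha
  exact ⟨z, (P.mem_ap_some).1 hz, hzβ⟩

theorem kleeneLE_of_mem_downImp₂ {α β γ : LowerSet P.carrier} {r : P.carrier}
    (h : r ∈ P.downImp α (P.downImp β γ)) :
    KleeneLE (P.down.ap (P.down.ap (Part.some (LowerSet.Iic r)) (Part.some α)) (Part.some β))
      (Part.some γ) := by
  refine (P.down_ap₂).2 ⟨fun s hs a ha => ?_, fun s hs a ha b hb => ?_⟩ <;>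
    obtain ⟨w, hw, hwβ⟩ := (P.downImp α (P.downImp β γ)).lower hs h a ha
  · exact Part.dom_iff_mem.2 ⟨w, (P.mem_ap_some).2 hw⟩
  · obtain ⟨z, hz, hzγ⟩ := hwβ b hb
    exact ⟨z, (P.mem_ap).2 ⟨w, (P.mem_ap_some).2 hw, b, Part.mem_some _, hz⟩, hzγ⟩

theorem exists_kleeneLE_iff {φ ψ : I → LowerSet P.carrier} :
    (∃ s ∈ P.down.filter, ∀ i, KleeneLE (P.down.ap (Part.some s) (Part.some (φ i)))
      (Part.some (ψ i))) ↔ P.downArr.Entails φ ψ := by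
  rw [entails_iff]
  constructor
  · rintro ⟨s, ⟨r, hr, hrs⟩, h⟩
    exact ⟨r, hr, fun i => mem_downImp_of_kleeneLE hrs (h i)⟩
  · rintro ⟨r, hr, h⟩
    exact ⟨LowerSet.Iic r, ⟨r, hr, le_rfl⟩, fun i => kleeneLE_of_mem_downImp (h i)⟩

theorem Hom.le_iff_entails {Q : PCA.{u}} {f g : Hom Q P.down} :
    f ≤ g ↔ P.downArr.Entails f.toFun g.toFun :=
  exists_kleeneLE_iff

/-! ### Existential quantification in the arrow algebra of downsets -/

/-- The union of a family of downsets along the fibres of `g`. -/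
def fiberUnion (g : X → Y) (α : X → LowerSet P.carrier) (y : Y) : LowerSet P.carrier :=
  ⨆ (x : X) (_ : g x = y), α x

theorem mem_fiberUnion {g : X → Y} {α : X → LowerSet P.carrier} {y : Y} {a : P.carrier} :
    a ∈ fiberUnion g α y ↔ ∃ x, g x = y ∧ a ∈ α x := by
  simp [fiberUnion, LowerSet.mem_iSup_iff]

theorem fiberUnion_entails_iff {g : X → Y} {α : X → LowerSet P.carrier}
    {ψ : Y → LowerSet P.carrier} :
    P.downArr.Entails (fiberUnion g α) ψ ↔
      P.downArr.Entails α (ψ ∘ g) := by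
  rw [entails_iff, entails_iff]
  refine exists_congr fun r => and_congr_right fun _ => ⟨fun h x a ha => ?_, fun h y a ha => ?_⟩
  · exact h (g x) a (mem_fiberUnion.2 ⟨x, rfl, ha⟩)
  · obtain ⟨x, rfl, hx⟩ := mem_fiberUnion.1 ha
    exact h x a hx

theorem entails_fiberUnion (g : X → Y) (α : X → LowerSet P.carrier) :
    P.downArr.Entails α (fiberUnion g α ∘ g) :=
  fiberUnion_entails_iff.1 (Entails.refl (A := P.downArr) _)

theorem exists_k_mem : ∃ k ∈ P.filter, ∀ α β : LowerSet P.carrier,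
    k ∈ P.downImp α (P.downImp β α) := by
  obtain ⟨k, hk, h⟩ := P.downArr.sep_k
  simp only [LowerSet.mem_iInf_iff] at h
  exact ⟨k, hk, h⟩

theorem fiberUnion_entails_ex (g : X → Y) (α : X → LowerSet P.carrier) :
    P.downArr.Entails (fiberUnion g α) (P.downArr.ex g α) := by
  obtain ⟨k, hk, hk'⟩ := P.exists_k_mem
  obtain ⟨r, hr, e, -, h⟩ := P.exists_lam₂ (.app (.const k) (.app (.var 0) (.var 1)))
    ⟨hk, trivial, trivial⟩
  refine fiberUnion_entails_iff.2 (entails_iff.2 ⟨r, hr, fun x a ha => ?_⟩)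
  obtain ⟨w, hw⟩ := Part.dom_iff_mem.1 (h a).1
  refine ⟨w, (P.mem_ap_some).1 hw, LowerSet.mem_iInf_iff.2 fun β b hb => ?_⟩
  simp only [LowerSet.mem_iInf_iff] at hb
  obtain ⟨c, hc, hcβ⟩ := hb x rfl a ha
  obtain ⟨d, hd, hdβ⟩ := hk' _ ⊤ c hcβ
  have h₁ := (h a).2 b
  rw [Part.eq_some_iff.2 hw] at h₁
  obtain ⟨z, hz, hzβ⟩ := P.mem_of_kleeneLE h₁ ⟨d, (P.mem_ap).2 ⟨k, Part.mem_some _, c,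
    (P.mem_ap_some).2 hc, hd⟩, hdβ⟩
  exact ⟨z, (P.mem_ap_some).1 hz, hzβ⟩

theorem ex_entails_fiberUnion (g : X → Y) (α : X → LowerSet P.carrier) :
    P.downArr.Entails (P.downArr.ex g α) (fiberUnion g α) := by
  obtain ⟨k, hk, hk'⟩ := P.exists_k_mem
  obtain ⟨r, hr, e, -, h⟩ := P.exists_lam₁
    (.app (.app (.app (.var 0) (.const k)) (.const k)) (.const k))
    ⟨⟨⟨trivial, hk⟩, hk⟩, hk⟩
  refine entails_iff.2 ⟨r, hr, fun y a ha => ?_⟩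
  obtain ⟨b, hb, hb'⟩ := LowerSet.mem_iInf_iff.1 ha (fiberUnion g α y) k (by
    simp only [LowerSet.mem_iInf_iff]
    exact fun x hx z hz => hk' (fiberUnion g α y) ⊤ z (mem_fiberUnion.2 ⟨x, hx, hz⟩))
  obtain ⟨c, hc, hc'⟩ := hb' k trivial
  obtain ⟨d, hd, hd'⟩ := hc' k trivial
  obtain ⟨z, hz, hz'⟩ := P.mem_of_kleeneLE (h a) ⟨d, (P.mem_ap).2 ⟨c, (P.mem_ap).2 ⟨b,
    (P.mem_ap_some).2 hb, k, Part.mem_some _, hc⟩, k, Part.mem_some _, hd⟩, hd'⟩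
  exact ⟨z, (P.mem_ap_some).1 hz, hz'⟩

/-! ### Conjunction in the arrow algebra of downsets -/

/-- The conjunction of downsets, in its second-order encoding. -/
def downConj (P : PCA.{u}) (α β : LowerSet P.carrier) : LowerSet P.carrier :=
  ⨅ γ : LowerSet P.carrier, P.downImp (P.downImp α (P.downImp β γ)) γ

theorem downConj_entails {φ ψ χ : I → LowerSet P.carrier}
    (h : P.downArr.Entails φ fun i => P.downImp (ψ i) (χ i)) :
    P.downArr.Entails (fun i => P.downConj (φ i) (ψ i)) χ := by
  obtain ⟨k, hk, hk'⟩ := entails_iff.1 h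
  obtain ⟨r, hr, e, -, h⟩ := P.exists_lam₁ (.app (.var 0) (.const k)) ⟨trivial, hk⟩
  refine entails_iff.2 ⟨r, hr, fun i a ha => ?_⟩
  obtain ⟨b, hb, hb'⟩ := LowerSet.mem_iInf_iff.1 ha (χ i) k (hk' i)
  obtain ⟨z, hz, hz'⟩ := P.mem_of_kleeneLE (h a) ⟨b, (P.mem_ap_some).2 hb, hb'⟩
  exact ⟨z, (P.mem_ap_some).1 hz, hz'⟩

theorem entails_imp_downConj (φ ψ : I → LowerSet P.carrier) :
    P.downArr.Entails φ fun i => P.downImp (ψ i) (P.downConj (φ i) (ψ i)) := by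
  obtain ⟨r, hr, e, -, h⟩ := P.exists_lam₃ (.app (.app (.var 0) (.var 2)) (.var 1))
    ⟨⟨trivial, trivial⟩, trivial⟩
  refine entails_iff.2 ⟨r, hr, fun i => P.mem_downImp₂ (fun x _ => P.dom_left (h x x).1)
    fun x hx y hy => ?_⟩
  obtain ⟨w, hw⟩ := Part.dom_iff_mem.1 (h x y).1
  refine ⟨w, hw, LowerSet.mem_iInf_iff.2 fun γ c hc => ?_⟩
  obtain ⟨p, hp, hp'⟩ := hc x hx
  obtain ⟨q, hq, hq'⟩ := hp' y hy
  have h₁ := (h x y).2 c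
  rw [Part.eq_some_iff.2 hw] at h₁
  obtain ⟨z, hz, hz'⟩ := P.mem_of_kleeneLE h₁ ⟨q, (P.mem_ap).2 ⟨p, (P.mem_ap_some).2 hp, y,
    Part.mem_some _, hq⟩, hq'⟩
  exact ⟨z, (P.mem_ap_some).1 hz, hz'⟩

theorem downConj_entails_left (φ ψ : I → LowerSet P.carrier) :
    P.downArr.Entails (fun i => P.downConj (φ i) (ψ i)) φ :=
  downConj_entails (k_family (A := P.downArr) φ ψ)

theorem downConj_entails_right (φ ψ : I → LowerSet P.carrier) :
    P.downArr.Entails (fun i => P.downConj (φ i) (ψ i)) ψ :=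
  downConj_entails (Entails.const_left (Entails.refl (A := P.downArr) ψ))

theorem entails_imp_of_downConj_entails {φ ψ χ : I → LowerSet P.carrier}
    (h : P.downArr.Entails (fun i => P.downConj (φ i) (ψ i)) χ) :
    P.downArr.Entails φ fun i => P.downImp (ψ i) (χ i) :=
  (entails_imp_downConj φ ψ).trans (Entails.imp_congr_right h)

end

/-! ### Morphisms between downset algebras -/

variable {P Q : PCA.{u}}

/-- An implicative morphism `F : DP → DQ` with a pointwise right adjoint `h`, which is uniform in
families, has an implicative right adjoint. -/
theorem _root_.RealArrow.ArrAlg.Hom.compDense_of_adjoint (F : ArrAlg.Hom P.downArr Q.downArr)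
    (h : LowerSet Q.carrier → LowerSet P.carrier)
    (counit : Q.downArr.Entails (F.toFun ∘ h) id)
    (transpose : ∀ {I : Type u} (φ : I → LowerSet P.carrier) (ψ : I → LowerSet Q.carrier),
      Q.downArr.Entails (F.toFun ∘ φ) ψ → P.downArr.Entails φ (h ∘ ψ)) :
    F.CompDense := by
  have h_mono : ∀ {I : Type u} {φ ψ : I → LowerSet Q.carrier}, Q.downArr.Entails φ ψ →
      P.downArr.Entails (h ∘ φ) (h ∘ ψ) := fun {I φ ψ} hφ =>
    transpose _ _ ((counit.reindex φ).trans hφ)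
  refine ⟨⟨h, fun β hβ => ?_, ?_, fun X hX => ?_⟩, ArrAlg.Hom.le_iff_entails.2 counit,
    ArrAlg.Hom.le_iff_entails.2 (transpose _ _ (Entails.refl (A := Q.downArr) F.toFun))⟩
  · have h₁ : P.downArr.Entails (fun _ : PUnit.{u + 1} => (⊤ : LowerSet P.carrier))
        (h ∘ fun _ => β) :=
      transpose _ _ (Entails.const_left (A := Q.downArr) (by rwa [iInf_const]))
    obtain ⟨r, hr, h₂⟩ := entails_iff.1 h₁
    exact P.downArr.sep_mp ⟨r, hr, h₂ PUnit.unit⟩ ⟨r, hr, trivial⟩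
  · let x : LowerSet Q.carrier × LowerSet Q.carrier → LowerSet P.carrier :=
      fun p => h (Q.downImp p.1 p.2)
    let y : LowerSet Q.carrier × LowerSet Q.carrier → LowerSet P.carrier := fun p => h p.1
    have h₁ : P.downArr.Entails (fun p => P.downConj (x p) (y p)) (h ∘ Prod.snd) := by
      refine transpose _ _ (Entails.mp (A := Q.downArr) (y := Prod.fst) ?_ ?_)
      · exact (F.map_entails (downConj_entails_left x y)).trans
          (counit.reindex fun p : LowerSet Q.carrier × LowerSet Q.carrier => Q.downImp p.1 p.2)
      · exact (F.map_entails (downConj_entails_right x y)).trans (counit.reindex Prod.fst)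
    obtain ⟨r, hr, h₂⟩ := exists_realizer.2 (entails_imp_of_downConj_entails h₁)
    exact ⟨r, hr, fun a a' => h₂ (a, a')⟩
  · rw [iInf_subtype'] at hX ⊢
    exact h_mono (φ := fun p : X => p.1.1) (ψ := fun p => p.1.2) hX

theorem _root_.RealArrow.ArrAlg.Hom.regular_iff (F : ArrAlg.Hom P.downArr Q.downArr) :
    F.Regular ↔ ∀ (X Y : Type u) (g : X → Y) (α : X → LowerSet P.carrier),
      Q.downArr.Entails (F.toFun ∘ fiberUnion g α)
        (fiberUnion g (F.toFun ∘ α)) := by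
  refine forall₄_congr fun X Y g α => ⟨fun h => ?_, fun h => ⟨?_, ?_⟩⟩
  · exact (F.map_entails (fiberUnion_entails_ex g α)).trans (h.1.trans (ex_entails_fiberUnion g _))
  · exact (F.map_entails (ex_entails_fiberUnion g α)).trans (h.trans (fiberUnion_entails_ex g _))
  · refine (ex_entails_fiberUnion g (F.toFun ∘ α)).trans (fiberUnion_entails_iff.2 ?_)
    exact F.map_entails ((entails_fiberUnion g α).trans ((fiberUnion_entails_ex g α).reindex g))

theorem _root_.RealArrow.ArrAlg.Hom.CompDense.regular {F : ArrAlg.Hom P.downArr Q.downArr}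
    (hF : F.CompDense) : F.Regular := by
  obtain ⟨h, h₁, h₂⟩ := hF
  refine F.regular_iff.2 fun X Y g α => ?_
  have h₃ : P.downArr.Entails (fiberUnion g α)
      (h.toFun ∘ fiberUnion g (F.toFun ∘ α)) :=
    fiberUnion_entails_iff.2 (((ArrAlg.Hom.le_iff_entails.1 h₂).reindex α).trans
      (h.map_entails (entails_fiberUnion g (F.toFun ∘ α))))
  exact (F.map_entails h₃).trans ((ArrAlg.Hom.le_iff_entails.1 h₁).reindex _)

theorem unionExt_toArr_regular (f : Hom P Q.down) : (unionExt f).toArr.Regular := by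
  refine (ArrAlg.Hom.regular_iff _).2 fun X Y g α =>
    Entails.of_le (A := Q.downArr) fun y b hb => ?_
  obtain ⟨a, ha, hb⟩ := mem_unionExt.1 hb
  obtain ⟨x, hx, ha⟩ := mem_fiberUnion.1 ha
  exact mem_fiberUnion.2 ⟨x, hx, mem_unionExt.2 ⟨a, ha, hb⟩⟩

theorem entails_unionExt_Iic (f : Hom P Q.down) :
    Q.downArr.Entails f.toFun ((unionExt f).toFun ∘ LowerSet.Iic) :=
  Entails.of_le (A := Q.downArr) fun a _ hb => mem_unionExt.2 ⟨a, le_rfl, hb⟩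

theorem unionExt_Iic_entails (f : Hom P Q.down) :
    Q.downArr.Entails ((unionExt f).toFun ∘ LowerSet.Iic) f.toFun := by
  obtain ⟨τ, ⟨v, hv, hvτ⟩, h⟩ := f.map_le
  refine entails_iff.2 ⟨v, hv, fun a b hb => ?_⟩
  obtain ⟨a', ha', hb⟩ := mem_unionExt.1 hb
  exact mem_downImp_of_kleeneLE hvτ (h a' a ha') b hb

theorem le_of_unionExt_toArr_le {f g : Hom P Q.down}
    (h : (unionExt f).toArr ≤ (unionExt g).toArr) : f ≤ g :=
  Hom.le_iff_entails.2 ((entails_unionExt_Iic f).trans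
    (((ArrAlg.Hom.le_iff_entails.1 h).reindex LowerSet.Iic).trans (unionExt_Iic_entails g)))

/-- An implicative morphism `DP → DQ` is a morphism of PCAs. -/
def _root_.RealArrow.ArrAlg.Hom.toPCA (F : ArrAlg.Hom P.downArr Q.downArr) :
    Hom P.down Q.down where
  toFun := F.toFun
  map_filter := F.map_sep
  map_app := by
    let I := {p : LowerSet P.carrier × LowerSet P.carrier × LowerSet P.carrier //
      p.2.2 ∈ P.downApp p.1 p.2.1}
    have h₁ : P.downArr.Entails (fun i : I => i.1.1) fun i => P.downImp i.1.2.1 i.1.2.2 :=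
      Entails.of_le (A := P.downArr) fun i x hx y hy => P.mem_of_downApp i.2 hx hy
    obtain ⟨r, hr, h⟩ := F.map_imp
    have h₂ : Q.downArr.Entails (fun i : I => F.toFun (P.downImp i.1.2.1 i.1.2.2))
        fun i => Q.downImp (F.toFun i.1.2.1) (F.toFun i.1.2.2) :=
      exists_realizer.1 ⟨r, hr, fun i => h i.1.2.1 i.1.2.2⟩
    obtain ⟨t, ht, h₃⟩ := entails_iff.1 ((F.map_entails h₁).trans h₂)
    exact ⟨LowerSet.Iic t, ⟨t, ht, le_rfl⟩, fun a a' c hc =>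
      kleeneLE_of_mem_downImp₂ (h₃ ⟨(a, a', c), hc⟩)⟩
  map_le := by
    let I := {p : LowerSet P.carrier × LowerSet P.carrier // p.1 ≤ p.2}
    have h₁ : P.downArr.Entails (fun i : I => i.1.1) fun i => i.1.2 :=
      Entails.of_le (A := P.downArr) fun i => i.2
    obtain ⟨s, hs, h⟩ := exists_kleeneLE_iff.2 (F.map_entails h₁)
    exact ⟨s, hs, fun a a' hle => h ⟨(a, a'), hle⟩⟩

/-- The restriction of an implicative morphism `DP → DQ` to principal downsets. -/
def _root_.RealArrow.ArrAlg.Hom.restrict (F : ArrAlg.Hom P.downArr Q.downArr) : Hom P Q.down :=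
  (unit P).comp F.toPCA

theorem _root_.RealArrow.ArrAlg.Hom.unionExt_restrict_le
    (F : ArrAlg.Hom P.downArr Q.downArr) : (unionExt F.restrict).toArr ≤ F := by
  let I := {p : P.carrier × LowerSet P.carrier // p.1 ∈ p.2}
  have h₁ : P.downArr.Entails (fun i : I => LowerSet.Iic i.1.1) fun i => i.1.2 :=
    Entails.of_le (A := P.downArr) fun i => LowerSet.Iic_le.2 i.2
  obtain ⟨r, hr, h⟩ := entails_iff.1 (F.map_entails h₁)
  refine ArrAlg.Hom.le_iff_entails.2 (entails_iff.2 ⟨r, hr, fun α b hb => ?_⟩)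
  obtain ⟨a, ha, hb⟩ := mem_unionExt.1 hb
  exact h ⟨(a, α), ha⟩ b hb

theorem _root_.RealArrow.ArrAlg.Hom.Regular.le_unionExt_restrict
    {F : ArrAlg.Hom P.downArr Q.downArr} (hF : F.Regular) :
    F ≤ (unionExt F.restrict).toArr := by
  let I := {p : P.carrier × LowerSet P.carrier // p.1 ∈ p.2}
  have h₁ := (ArrAlg.Hom.regular_iff F).1 hF I _ (fun i => i.1.2) (fun i => LowerSet.Iic i.1.1)
  refine ArrAlg.Hom.le_iff_entails.2 (Entails.trans (A := Q.downArr) (Entails.trans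
    (A := Q.downArr) (F.map_entails (x := id) (Entails.of_le (A := P.downArr) fun α a ha => ?_))
    h₁) (Entails.of_le (A := Q.downArr) fun α b hb => ?_))
  · exact mem_fiberUnion.2 ⟨⟨(a, α), ha⟩, rfl, le_rfl⟩
  · obtain ⟨i, rfl, hi⟩ := mem_fiberUnion.1 hb
    exact mem_unionExt.2 ⟨i.1.1, i.2, hi⟩

/-! ### Computational density -/

theorem Hom.compDense_iff {f : Hom P Q.down} :
    f.CompDense ↔ ∃ m ∈ Q.filter, ∀ s ∈ Q.filter, ∃ r ∈ P.filter, ∀ (a : P.carrier)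
      (β : LowerSet Q.carrier), s ∈ Q.downImp (f.toFun a) β →
        ∃ z ∈ P.app r a, m ∈ Q.downImp (f.toFun z) β := by
  constructor
  · rintro ⟨μ, ⟨m, hm, hmμ⟩, h⟩
    refine ⟨m, hm, fun s hs => ?_⟩
    obtain ⟨r, hr, h⟩ := h (LowerSet.Iic s) ⟨s, hs, le_rfl⟩
    refine ⟨r, hr, fun a β hβ => ?_⟩
    obtain ⟨δ, hδ, hle⟩ := kleeneLE_some.1 ((h a).trans (kleeneLE_of_mem_downImp hβ))
    obtain ⟨_, hn, ω, hω, hδ⟩ := (Q.down.mem_ap).1 hδ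
    obtain rfl := Part.mem_some_iff.1 hn
    obtain ⟨z, hz, rfl⟩ := (Part.mem_map_iff _).1 hω
    exact ⟨z, hz, mem_downImp_of_kleeneLE hmμ
      (kleeneLE_some.2 ⟨δ, (Q.down.mem_ap_some).2 hδ, hle⟩)⟩
  · rintro ⟨m, hm, h⟩
    refine ⟨LowerSet.Iic m, ⟨m, hm, le_rfl⟩, ?_⟩
    rintro σ ⟨s, hs, hsσ⟩
    obtain ⟨r, hr, h⟩ := h s hs
    refine ⟨r, hr, fun a δ hδ => ?_⟩
    obtain ⟨z, hz, hm'⟩ := h a δ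
      (mem_downImp_of_kleeneLE hsσ (kleeneLE_some.2 ⟨δ, hδ, le_rfl⟩))
    rw [← kleeneLE_some, Part.eq_some_iff.2 hz, Part.map_some]
    exact kleeneLE_of_mem_downImp hm'

theorem Hom.CompDense.unionExt_toArr {f : Hom P Q.down} (hf : f.CompDense) :
    (unionExt f).toArr.CompDense := by
  obtain ⟨m, hm, hd⟩ := Hom.compDense_iff.1 hf
  let h : LowerSet Q.carrier → LowerSet P.carrier := fun β =>
    lowerClosure {a | m ∈ Q.downImp (f.toFun a) β}
  refine ArrAlg.Hom.compDense_of_adjoint _ h ?_ fun {I} φ ψ hφ => ?_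
  · let J := {p : P.carrier × LowerSet Q.carrier // m ∈ Q.downImp (f.toFun p.1) p.2}
    have h₁ : Q.downArr.Entails (fun j : J => f.toFun j.1.1) fun j => j.1.2 :=
      entails_iff.2 ⟨m, hm, fun j => j.2⟩
    obtain ⟨r, hr, h₂⟩ := entails_iff.1
      (((unionExt_Iic_entails f).reindex fun j : J => j.1.1).trans h₁)
    refine entails_iff.2 ⟨r, hr, fun β b hb => ?_⟩
    obtain ⟨a, ⟨a', ha', hle⟩, hb⟩ := mem_unionExt.1 hb
    exact h₂ ⟨(a', β), ha'⟩ b (mem_unionExt.2 ⟨a, hle, hb⟩)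
  · obtain ⟨s, hs, h₁⟩ := entails_iff.1 hφ
    obtain ⟨r, hr, h₂⟩ := hd s hs
    refine entails_iff.2 ⟨r, hr, fun i a ha => ?_⟩
    obtain ⟨z, hz, h₃⟩ := h₂ a (ψ i) fun b hb => h₁ i b (mem_unionExt.2 ⟨a, ha, hb⟩)
    exact ⟨z, hz, subset_lowerClosure h₃⟩

theorem Hom.compDense_of_unionExt_toArr {f : Hom P Q.down}
    (hf : (unionExt f).toArr.CompDense) : f.CompDense := by
  obtain ⟨h, h₁, h₂⟩ := hf
  obtain ⟨m, hm, hm'⟩ := entails_iff.1 (ArrAlg.Hom.le_iff_entails.1 h₁)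
  refine Hom.compDense_iff.2 ⟨m, hm, fun s hs => ?_⟩
  let I := {p : P.carrier × LowerSet Q.carrier // s ∈ Q.downImp (f.toFun p.1) p.2}
  have h₃ : Q.downArr.Entails (fun i : I => f.toFun i.1.1) fun i => i.1.2 :=
    entails_iff.2 ⟨s, hs, fun i => i.2⟩
  have h₄ := ((unionExt_Iic_entails f).reindex fun i : I => i.1.1).trans h₃
  obtain ⟨r, hr, h₅⟩ := entails_iff.1 (((ArrAlg.Hom.le_iff_entails.1 h₂).reindex
    fun i : I => LowerSet.Iic i.1.1).trans (h.map_entails h₄))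
  refine ⟨r, hr, fun a β hβ => ?_⟩
  obtain ⟨z, hz, hzβ⟩ := h₅ ⟨(a, β), hβ⟩ a le_rfl
  exact ⟨z, hz, fun b hb => hm' β b (mem_unionExt.2 ⟨z, hzβ, hb⟩)⟩

theorem Hom.compDense_iff_unionExt_toArr {f : Hom P Q.down} :
    f.CompDense ↔ (unionExt f).toArr.CompDense :=
  ⟨Hom.CompDense.unionExt_toArr, Hom.compDense_of_unionExt_toArr⟩

end PCA

end RealArrow

theorem proposition7p17 :
    (∃ h : ∀ {A B : OPCAD.{u}} (f : A ⟶ B), ArrAlg.regular.mem (downFunctor.map f),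
      TwoFullyFaithful (corestrict downFunctor ArrAlg.regular h)) ∧
    (∃ h : ∀ {A B : Wide OPCAD.compDense.{u}} (f : A ⟶ B),
        ArrAlg.compDense.mem (((Wide.incl OPCAD.compDense).comp downFunctor).map f),
      TwoFullyFaithful
        (corestrict ((Wide.incl OPCAD.compDense).comp downFunctor) ArrAlg.compDense h)) ∧
    ∀ {A B : OPCAD.{u}} (f : A ⟶ B),
      OPCAD.compDense.mem f ↔ ArrAlg.compDense.mem (downFunctor.map f) := by
  refine ⟨⟨fun f => PCA.unionExt_toArr_regular f, twoFullyFaithful_of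
      (fun f g hfg => PCA.le_of_unionExt_toArr_le hfg) fun {A B} F => ?_⟩,
    ⟨fun f => PCA.Hom.CompDense.unionExt_toArr f.mem, twoFullyFaithful_of
      (fun f g hfg => PCA.le_of_unionExt_toArr_le hfg) fun {A B} F => ?_⟩,
    fun f => PCA.Hom.compDense_iff_unionExt_toArr⟩
  · obtain ⟨F, hF⟩ := F
    exact ⟨ArrAlg.Hom.restrict F, ArrAlg.Hom.unionExt_restrict_le F,
      ArrAlg.Hom.Regular.le_unionExt_restrict hF⟩
  · obtain ⟨F, hF⟩ := F
    have h₁ := ArrAlg.Hom.unionExt_restrict_le F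
    have h₂ := (ArrAlg.Hom.CompDense.regular hF).le_unionExt_restrict
    exact ⟨⟨ArrAlg.Hom.restrict F, PCA.Hom.compDense_of_unionExt_toArr
      (ArrAlg.Hom.CompDense.congr hF h₂ h₁)⟩, h₁, h₂⟩
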